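/- Let $\Omega_1\subset\Omega_2\subset\cdots$ be domains (non-empty connected open sets) in $\mathbb{C}^n$ with union $\Omega$. For an open set $D\subset\mathbb{C}^n$, let $A^2(D)$ be the Bergman space of square integrable holomorphic functions on $D$ (with respect to Lebesgue measure), a closed subspace of $L^2(D)$; let $P_D:L^2(D)\to A^2(D)$ be the orthogonal projection and let $K^D(w,z)=K^D_z(w)$ be the Bergman kernel, so that $f(z)=\langle f,K^D_z\rangle$ for all $f\in A^2(D)$ and $z\in D$. Put $\mathcal{Z}_D=\{z\in D: K^D(z,z)=0\}$ and $\mathcal{Z}=\mathcal{Z}_\Omega$. For $z\in D\setminus\mathcal{Z}_D$ let $k^D_z=K^D_z/\sqrt{K^D(z,z)}$, and for a bounded linear operator $T$ on $A^2(D)$ let $B_DT(z)=\langle Tk^D_z,k^D_z\rangle$ be its Berezin transform. For $\phi\in L^\infty(D)$ let $T_\phi f=P_D(\phi f)$ be the Toeplitz operator on $A^2(D)$ with symbol $\phi$. Let $E$ denote extension of functions by zero. Assume that $\Omega$ is a non-trivial Bergman domain, i.e. $A^2(\Omega)\neq\{0\}$. Let $\phi_{m,i}\in L^\infty(\Omega)$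 for $1\le m\le l$, $1\le i\le k_m$, and put $$T=\sum_{m=1}^{l}T_{\phi_{m,1}}\cdots T_{\phi_{m,k_m}}\ \text{ on } A^2(\Omega),\qquad T^{\Omega_j}=\sum_{m=1}^{l}T_{\phi_{m,1}|_{\Omega_j}}\cdots T_{\phi_{m,k_m}|_{\Omega_j}}\ \text{ on } A^2(\Omega_j).$$ Then, for every compact set $K\subset\Omega\setminus\mathcal{Z}$, one has $K\subset\Omega_j\setminus\mathcal{Z}_{\Omega_j}$ for all sufficiently large $j$, and $B_{\Omega_j}T^{\Omega_j}\to B_\Omega T$ uniformly on $K$ as $j\to\infty$. Furthermore, if $\Omega$ is bounded, then for every $0<p<\infty$ the functions $EB_{\Omega_j}T^{\Omega_j}$ and $B_\Omega T$ belong to $L^p(\Omega)$ and $EB_{\Omega_j}T^{\Omega_j}\to B_\Omega T$ in $L^p(\Omega)$, i.e. $\int_\Omega |EB_{\Omega_j}T^{\Omega_j}-B_\Omega T|^p\,dV\to 0$, as $j\to\infty$. -/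

import Mathlib

open MeasureTheory Filter Topology TopologicalSpace Metric
open scoped ENNReal NNReal

noncomputable section

namespace Bergman

/-! ### Interior estimates for square integrable holomorphic functions -/

/-- Multiplication by a unimodular constant preserves Lebesgue measure on `ℂⁿ`. -/
theorem measurePreserving_unit_smul {n : ℕ} (c : ℂ) (hc : ‖c‖ = 1) :
    MeasurePreserving (fun v : Fin n → ℂ => c • v) volume volume := by
  have h1 : MeasurePreserving (fun z : ℂ => c * z) volume volume := by
    have h := (rotation ⟨c, by simp [Submonoid.unitSphere, hc]⟩).measurePreserving
    exact h
  exact volume_preserving_pi (fun _ : Fin n => h1)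

/-- The mean value inequality over a ball: a holomorphic function is controlled at the centre of a
closed ball contained in its domain by its mean over the open ball. -/
theorem enorm_mul_volume_ball_le {n : ℕ} {Ω : Set (Fin n → ℂ)}
    {g : (Fin n → ℂ) → ℂ} (hg : DifferentiableOn ℂ g Ω) {w : Fin n → ℂ} {r : ℝ}
    (hw : closedBall w r ⊆ Ω) :
    ‖g w‖ₑ * volume (ball (0 : Fin n → ℂ) r) ≤ ∫⁻ v in ball w r, ‖g v‖ₑ := by
  classical
  set G : (Fin n → ℂ) → ℝ≥0∞ := (ball w r).indicator (fun v => ‖g v‖ₑ) with hG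
  have hsub : ball w r ⊆ Ω := ball_subset_closedBall.trans hw
  have hGm : Measurable G := by
    have hc : ContinuousOn (fun v => ‖g v‖ₑ) (ball w r) := (hg.continuousOn.mono hsub).enorm
    have := hc.measurable_piecewise (g := fun _ => (0 : ℝ≥0∞)) continuousOn_const
      isOpen_ball.measurableSet
    have h0 : (ball w r).piecewise (fun v => ‖g v‖ₑ) (fun _ => (0 : ℝ≥0∞)) = G :=
      Set.piecewise_eq_indicator
    rwa [h0] at this
  have hGint : ∫⁻ v, G v = ∫⁻ v in ball w r, ‖g v‖ₑ :=
    lintegral_indicator isOpen_ball.measurableSet _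
  -- one-variable mean value inequality on the complex line through `w` in the direction `v`
  have key : ∀ v ∈ ball (0 : Fin n → ℂ) r,
      ENNReal.ofReal (2 * Real.pi) * ‖g w‖ₑ ≤
        ∫⁻ θ in Set.Ioc 0 (2 * Real.pi), G (w + circleMap 0 1 θ • v) := by
    intro v hv
    have hv' : ‖v‖ < r := by simpa using hv
    have hin : ∀ t : ℂ, ‖t‖ ≤ 1 → w + t • v ∈ ball w r := by
      intro t ht
      rw [mem_ball, dist_eq_norm, add_sub_cancel_left, norm_smul]
      exact lt_of_le_of_lt (mul_le_of_le_one_left (norm_nonneg _) ht) hv'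
    have hd : DifferentiableOn ℂ (fun t : ℂ => g (w + t • v)) (closedBall 0 1) := by
      refine hg.comp (by fun_prop) fun t ht => hsub (hin t (by simpa using ht))
    have hcl : DiffContOnCl ℂ (fun t : ℂ => g (w + t • v)) (ball 0 |1|) := by
      refine DifferentiableOn.diffContOnCl ?_
      rw [abs_one, closure_ball _ one_ne_zero]
      exact hd
    have hmv := hcl.circleAverage
    rw [Real.circleAverage_def] at hmv
    simp only [zero_smul, add_zero] at hmv
    have h2 : (2 * Real.pi : ℝ) • g w =
        ∫ θ in (0 : ℝ)..(2 * Real.pi), g (w + circleMap 0 1 θ • v) := by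
      rw [← hmv, smul_smul, mul_inv_cancel₀ (by positivity), one_smul]
    have h3 : ENNReal.ofReal (2 * Real.pi) * ‖g w‖ₑ = ‖(2 * Real.pi : ℝ) • g w‖ₑ := by
      rw [enorm_smul, Real.enorm_eq_ofReal (by positivity)]
    rw [h3, h2, intervalIntegral.integral_of_le (by positivity)]
    refine (enorm_integral_le_lintegral_enorm _).trans (le_of_eq ?_)
    refine lintegral_congr fun θ => ?_
    rw [hG, Set.indicator_of_mem (hin _ (by simp))]
  have hswap : ∫⁻ v, ∫⁻ θ in Set.Ioc 0 (2 * Real.pi), G (w + circleMap 0 1 θ • v) =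
      ENNReal.ofReal (2 * Real.pi) * ∫⁻ v, G v := by
    rw [lintegral_lintegral_swap]
    · have : ∀ θ : ℝ, ∫⁻ v, G (w + circleMap 0 1 θ • v) = ∫⁻ v, G v := by
        intro θ
        rw [(measurePreserving_unit_smul (circleMap 0 1 θ) (by simp)).lintegral_comp
          (f := fun v => G (w + v)) (by fun_prop)]
        exact lintegral_add_left_eq_self G w
      simp only [this, lintegral_const, Measure.restrict_apply_univ, Real.volume_Ioc, sub_zero]
      rw [mul_comm]
    · refine Measurable.aemeasurable ?_
      refine hGm.comp ?_
      have : Measurable (circleMap 0 1) := (continuous_circleMap 0 1).measurable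
      fun_prop
  have hpi : ENNReal.ofReal (2 * Real.pi) ≠ 0 := by
    simp [Real.pi_pos]
  refine (ENNReal.mul_le_mul_iff_right hpi ENNReal.ofReal_ne_top).1 ?_
  rw [← hGint, ← hswap, ← mul_assoc]
  calc ENNReal.ofReal (2 * Real.pi) * ‖g w‖ₑ * volume (ball (0 : Fin n → ℂ) r)
      = ∫⁻ _ in ball (0 : Fin n → ℂ) r, ENNReal.ofReal (2 * Real.pi) * ‖g w‖ₑ := by
        rw [setLIntegral_const]
    _ ≤ ∫⁻ v in ball (0 : Fin n → ℂ) r,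
          ∫⁻ θ in Set.Ioc 0 (2 * Real.pi), G (w + circleMap 0 1 θ • v) :=
        setLIntegral_mono' isOpen_ball.measurableSet key
    _ ≤ _ := setLIntegral_le_lintegral _ _

/-- The Bergman inequality: point values of a holomorphic function at distance at least `r` from the
boundary are bounded by its `L²` norm, with a constant depending only on `r` and the dimension. -/
theorem exists_enorm_le_eLpNorm (n : ℕ) {r : ℝ} (hr : 0 < r) :
    ∃ C : ℝ≥0, ∀ (Ω : Set (Fin n → ℂ)), ∀ g : (Fin n → ℂ) → ℂ,
      DifferentiableOn ℂ g Ω → ∀ w, closedBall w r ⊆ Ω →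
        ‖g w‖ₑ ≤ C * eLpNorm g 2 (volume.restrict Ω) := by
  set V := volume (ball (0 : Fin n → ℂ) r) with hV
  have hV0 : V ≠ 0 := (measure_ball_pos _ _ hr).ne'
  have hVt : V ≠ ∞ := measure_ball_lt_top.ne
  have hC : V ^ ((1 : ℝ) / 1 - 1 / 2) / V ≠ ∞ :=
    ENNReal.div_ne_top (ENNReal.rpow_ne_top_of_nonneg (by norm_num) hVt) hV0
  refine ⟨(V ^ ((1 : ℝ) / 1 - 1 / 2) / V).toNNReal, fun Ω g hg w hw => ?_⟩
  rw [ENNReal.coe_toNNReal hC]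
  have hsub : ball w r ⊆ Ω := ball_subset_closedBall.trans hw
  have h1 := enorm_mul_volume_ball_le hg hw
  have hVw : volume (ball w r) = V := by
    rw [hV, Measure.addHaar_ball_center]
  have hm : AEStronglyMeasurable g (volume.restrict (ball w r)) :=
    (hg.continuousOn.mono hsub).aestronglyMeasurable isOpen_ball.measurableSet
  have h2 := eLpNorm_le_eLpNorm_mul_rpow_measure_univ (p := 1) (q := 2) (by norm_num) hm
  rw [eLpNorm_one_eq_lintegral_enorm, Measure.restrict_apply_univ, hVw] at h2
  simp only [ENNReal.toReal_one, ENNReal.toReal_ofNat] at h2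
  have h3 : eLpNorm g 2 (volume.restrict (ball w r)) ≤ eLpNorm g 2 (volume.restrict Ω) :=
    eLpNorm_mono_measure _ (Measure.restrict_mono hsub le_rfl)
  have h4 : ‖g w‖ₑ * V ≤ eLpNorm g 2 (volume.restrict Ω) * V ^ ((1 : ℝ) / 1 - 1 / 2) :=
    h1.trans (h2.trans (by gcongr))
  rw [← ENNReal.le_div_iff_mul_le (Or.inl hV0) (Or.inl hVt)] at h4
  refine h4.trans (le_of_eq ?_)
  rw [mul_div_assoc, mul_comm]

/-- The corresponding estimate for the derivative. -/
theorem exists_norm_fderiv_le_eLpNorm (n : ℕ) {r : ℝ} (hr : 0 < r) :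
    ∃ C : ℝ≥0, ∀ (Ω : Set (Fin n → ℂ)), IsOpen Ω → ∀ g : (Fin n → ℂ) → ℂ,
      DifferentiableOn ℂ g Ω → eLpNorm g 2 (volume.restrict Ω) ≠ ∞ →
        ∀ w, closedBall w (2 * r) ⊆ Ω →
          ‖fderiv ℂ g w‖ ≤ C * (eLpNorm g 2 (volume.restrict Ω)).toReal := by
  obtain ⟨C, hC⟩ := exists_enorm_le_eLpNorm n hr
  refine ⟨C / r.toNNReal, fun Ω hΩ g hg hfin w hw => ?_⟩
  have hrr : (r.toNNReal : ℝ) = r := Real.coe_toNNReal _ hr.le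
  have hval : ∀ u ∈ closedBall w r, ‖g u‖ ≤ C * (eLpNorm g 2 (volume.restrict Ω)).toReal := by
    intro u hu
    have hsub : closedBall u r ⊆ Ω := by
      refine (closedBall_subset_closedBall' ?_).trans hw
      rw [mem_closedBall] at hu
      linarith
    have := ENNReal.toReal_mono (ENNReal.mul_ne_top ENNReal.coe_ne_top hfin) (hC Ω g hg u hsub)
    simpa [ENNReal.toReal_mul] using this
  set M := (C : ℝ) * (eLpNorm g 2 (volume.restrict Ω)).toReal with hM
  have hM0 : 0 ≤ M := by positivity
  have hdw : DifferentiableAt ℂ g w :=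
    (hg w (hw (mem_closedBall_self (by positivity)))).differentiableAt
      (hΩ.mem_nhds (hw (mem_closedBall_self (by positivity))))
  have hgoal : ‖fderiv ℂ g w‖ ≤ M / r := by
    refine ContinuousLinearMap.opNorm_le_bound _ (by positivity) fun v => ?_
    rcases eq_or_ne v 0 with rfl | hv
    · simp
    have hvn : 0 < ‖v‖ := norm_pos_iff.2 hv
    have hin : ∀ t : ℂ, t ∈ closedBall (0 : ℂ) (r / ‖v‖) → w + t • v ∈ closedBall w r := by
      intro t ht
      rw [mem_closedBall, dist_zero_right, le_div_iff₀ hvn] at ht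
      rw [mem_closedBall, dist_eq_norm, add_sub_cancel_left, norm_smul]
      exact ht
    have hd : DifferentiableOn ℂ (fun t : ℂ => g (w + t • v)) (closedBall 0 (r / ‖v‖)) := by
      refine hg.comp (by fun_prop) fun t ht =>
        hw (closedBall_subset_closedBall (by linarith) (hin t ht))
    have hcl : DiffContOnCl ℂ (fun t : ℂ => g (w + t • v)) (ball 0 (r / ‖v‖)) := by
      refine DifferentiableOn.diffContOnCl ?_
      rw [closure_ball _ (by positivity)]
      exact hd
    have h1 := Complex.norm_deriv_le_of_forall_mem_sphere_norm_le (by positivity) hcl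
      (fun z hz => hval _ (hin z (sphere_subset_closedBall hz)))
    have h2 : HasDerivAt (fun t : ℂ => g (w + t • v)) (fderiv ℂ g w v) 0 := by
      have h3 : HasDerivAt (fun t : ℂ => w + t • v) v 0 := by
        simpa using ((hasDerivAt_id (0 : ℂ)).smul_const v).const_add w
      have h4 : HasFDerivAt g (fderiv ℂ g w) (w + (0 : ℂ) • v) := by
        simpa using hdw.hasFDerivAt
      exact h4.comp_hasDerivAt 0 h3
    rw [h2.deriv] at h1
    refine h1.trans (le_of_eq ?_)
    field_simp
  refine hgoal.trans (le_of_eq ?_)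
  rw [hM, NNReal.coe_div, hrr]
  ring

/-! ### The Bergman space -/

/-- The Bergman space `A²(Ω)`: the classes in `L²(Ω)` (Lebesgue measure on `Ω`) that have a
representative which is holomorphic on `Ω`. -/
def bergmanSpace {n : ℕ} (Ω : Opens (Fin n → ℂ)) :
    Submodule ℂ (Lp ℂ 2 (volume.restrict (Ω : Set (Fin n → ℂ)))) where
  carrier := {f | ∃ g : (Fin n → ℂ) → ℂ, DifferentiableOn ℂ g Ω ∧
    f =ᵐ[volume.restrict (Ω : Set (Fin n → ℂ))] g}
  zero_mem' := ⟨0, differentiableOn_const 0, Lp.coeFn_zero _ _ _⟩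
  add_mem' := by
    rintro f₁ f₂ ⟨g₁, hg₁, h₁⟩ ⟨g₂, hg₂, h₂⟩
    exact ⟨g₁ + g₂, hg₁.add hg₂, (Lp.coeFn_add f₁ f₂).trans (h₁.add h₂)⟩
  smul_mem' := by
    rintro c f ⟨g, hg, h⟩
    exact ⟨c • g, hg.const_smul c, (Lp.coeFn_smul c f).trans (h.const_smul c)⟩

/-- The holomorphic representative of an element of the Bergman space; its values on `Ω` are
uniquely determined (`eqOn_holo`). -/
def holo {n : ℕ} {Ω : Opens (Fin n → ℂ)} (f : bergmanSpace Ω) : (Fin n → ℂ) → ℂ :=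
  Classical.choose f.2

theorem differentiableOn_holo {n : ℕ} {Ω : Opens (Fin n → ℂ)} (f : bergmanSpace Ω) :
    DifferentiableOn ℂ (holo f) Ω :=
  (Classical.choose_spec f.2).1

theorem coeFn_ae_eq_holo {n : ℕ} {Ω : Opens (Fin n → ℂ)} (f : bergmanSpace Ω) :
    (f : Lp ℂ 2 (volume.restrict (Ω : Set (Fin n → ℂ))))
      =ᵐ[volume.restrict (Ω : Set (Fin n → ℂ))] holo f :=
  (Classical.choose_spec f.2).2

theorem eqOn_holo {n : ℕ} {Ω : Opens (Fin n → ℂ)} (f : bergmanSpace Ω) {g : (Fin n → ℂ) → ℂ}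
    (hg : DifferentiableOn ℂ g Ω)
    (hfg : (f : Lp ℂ 2 (volume.restrict (Ω : Set (Fin n → ℂ))))
      =ᵐ[volume.restrict (Ω : Set (Fin n → ℂ))] g) :
    Set.EqOn (holo f) g Ω :=
  Measure.eqOn_open_of_ae_eq ((coeFn_ae_eq_holo f).symm.trans hfg) Ω.isOpen
    (differentiableOn_holo f).continuousOn hg.continuousOn

theorem eLpNorm_holo {n : ℕ} {Ω : Opens (Fin n → ℂ)} (f : bergmanSpace Ω) :
    eLpNorm (holo f) 2 (volume.restrict (Ω : Set (Fin n → ℂ))) = ‖f‖ₑ := by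
  rw [← eLpNorm_congr_ae (coeFn_ae_eq_holo f), ← Lp.enorm_def]
  rfl

theorem holo_add {n : ℕ} {Ω : Opens (Fin n → ℂ)} (f g : bergmanSpace Ω) :
    Set.EqOn (holo (f + g)) (holo f + holo g) Ω :=
  eqOn_holo _ ((differentiableOn_holo f).add (differentiableOn_holo g))
    ((Lp.coeFn_add _ _).trans ((coeFn_ae_eq_holo f).add (coeFn_ae_eq_holo g)))

theorem holo_smul {n : ℕ} {Ω : Opens (Fin n → ℂ)} (c : ℂ) (f : bergmanSpace Ω) :
    Set.EqOn (holo (c • f)) (c • holo f) Ω :=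
  eqOn_holo _ ((differentiableOn_holo f).const_smul c)
    ((Lp.coeFn_smul _ _).trans ((coeFn_ae_eq_holo f).const_smul c))

theorem holo_sub {n : ℕ} {Ω : Opens (Fin n → ℂ)} (f g : bergmanSpace Ω) :
    Set.EqOn (holo (f - g)) (holo f - holo g) Ω :=
  eqOn_holo _ ((differentiableOn_holo f).sub (differentiableOn_holo g))
    ((Lp.coeFn_sub _ _).trans ((coeFn_ae_eq_holo f).sub (coeFn_ae_eq_holo g)))

/-- Point values are bounded by the norm, uniformly at distance at least `r` from the boundary. -/
theorem exists_norm_holo_le (n : ℕ) {r : ℝ} (hr : 0 < r) :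
    ∃ C : ℝ≥0, ∀ (Ω : Opens (Fin n → ℂ)) (f : bergmanSpace Ω) (w : Fin n → ℂ),
      closedBall w r ⊆ (Ω : Set (Fin n → ℂ)) → ‖holo f w‖ ≤ C * ‖f‖ := by
  obtain ⟨C, hC⟩ := exists_enorm_le_eLpNorm n hr
  refine ⟨C, fun Ω f w hw => ?_⟩
  have := hC Ω (holo f) (differentiableOn_holo f) w hw
  rw [eLpNorm_holo] at this
  have := ENNReal.toReal_mono (ENNReal.mul_ne_top ENNReal.coe_ne_top enorm_ne_top) this
  simpa [ENNReal.toReal_mul] using this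

theorem exists_norm_fderiv_holo_le (n : ℕ) {r : ℝ} (hr : 0 < r) :
    ∃ C : ℝ≥0, ∀ (Ω : Opens (Fin n → ℂ)) (f : bergmanSpace Ω) (w : Fin n → ℂ),
      closedBall w (2 * r) ⊆ (Ω : Set (Fin n → ℂ)) → ‖fderiv ℂ (holo f) w‖ ≤ C * ‖f‖ := by
  obtain ⟨C, hC⟩ := exists_norm_fderiv_le_eLpNorm n hr
  refine ⟨C, fun Ω f w hw => ?_⟩
  have := hC Ω Ω.isOpen (holo f) (differentiableOn_holo f)
    (by rw [eLpNorm_holo]; exact enorm_ne_top) w hw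
  simpa [eLpNorm_holo] using this

/-- `A²(Ω)` is closed in `L²(Ω)`. -/
theorem isClosed_bergmanSpace {n : ℕ} (Ω : Opens (Fin n → ℂ)) :
    IsClosed (bergmanSpace Ω : Set (Lp ℂ 2 (volume.restrict (Ω : Set (Fin n → ℂ))))) := by
  refine IsSeqClosed.isClosed fun F f hF hf => ?_
  set u : ℕ → bergmanSpace Ω := fun k => ⟨F k, hF k⟩ with hu
  have hcau : CauchySeq u := by
    have h1 : CauchySeq F := hf.cauchySeq
    rw [Metric.cauchySeq_iff] at h1 ⊢
    exact h1
  have hcau' := Metric.cauchySeq_iff.1 hcau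
  -- the holomorphic representatives form a Cauchy sequence at each point, uniformly on small balls
  have hpt : ∀ x ∈ (Ω : Set (Fin n → ℂ)), ∃ y, Tendsto (fun k => holo (u k) x) atTop (𝓝 y) := by
    intro x hx
    obtain ⟨r, hr, hxr⟩ := Metric.nhds_basis_closedBall.mem_iff.1 (Ω.isOpen.mem_nhds hx)
    obtain ⟨C, hC⟩ := exists_norm_holo_le n hr
    refine cauchySeq_tendsto_of_complete (Metric.cauchySeq_iff.2 fun ε hε => ?_)
    obtain ⟨N, hN⟩ := hcau' (ε / (C + 1)) (by positivity)
    refine ⟨N, fun a ha b hb => ?_⟩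
    have h1 := hC Ω (u a - u b) x hxr
    rw [holo_sub _ _ hx, Pi.sub_apply] at h1
    have h2 := hN a ha b hb
    rw [dist_eq_norm, lt_div_iff₀ (by positivity)] at h2
    rw [dist_eq_norm]
    nlinarith [norm_nonneg (u a - u b)]
  choose! g hg using hpt
  have hgd : DifferentiableOn ℂ g Ω := by
    intro x hx
    obtain ⟨r, hr, hxr⟩ := Metric.nhds_basis_closedBall.mem_iff.1 (Ω.isOpen.mem_nhds hx)
    obtain ⟨C, hC⟩ := exists_norm_fderiv_holo_le n (r := r / 4) (by positivity)
    have hsub : ball x (r / 2) ⊆ (Ω : Set (Fin n → ℂ)) :=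
      (ball_subset_closedBall.trans (closedBall_subset_closedBall (by linarith))).trans hxr
    have hball : ∀ y ∈ ball x (r / 2), closedBall y (2 * (r / 4)) ⊆ (Ω : Set (Fin n → ℂ)) := by
      intro y hy
      refine (closedBall_subset_closedBall' ?_).trans hxr
      rw [mem_ball] at hy
      linarith
    have hda : ∀ k, ∀ y ∈ (Ω : Set (Fin n → ℂ)), DifferentiableAt ℂ (holo (u k)) y := fun k y hy =>
      (differentiableOn_holo (u k) y hy).differentiableAt (Ω.isOpen.mem_nhds hy)
    have hunif : UniformCauchySeqOn (fun k y => fderiv ℂ (holo (u k)) y) atTop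
        (ball x (r / 2)) := by
      rw [Metric.uniformCauchySeqOn_iff]
      intro ε hε
      obtain ⟨N, hN⟩ := hcau' (ε / (C + 1)) (by positivity)
      refine ⟨N, fun a ha b hb y hy => ?_⟩
      have h1 := hC Ω (u a - u b) y (hball y hy)
      have h3 : fderiv ℂ (holo (u a - u b)) y
          = fderiv ℂ (holo (u a)) y - fderiv ℂ (holo (u b)) y := by
        rw [← fderiv_sub (hda a y (hsub hy)) (hda b y (hsub hy))]
        exact ((holo_sub (u a) (u b)).eventuallyEq_of_mem
          (Ω.isOpen.mem_nhds (hsub hy))).fderiv_eq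
      rw [h3] at h1
      have h2 := hN a ha b hb
      rw [dist_eq_norm, lt_div_iff₀ (by positivity)] at h2
      rw [dist_eq_norm]
      nlinarith [norm_nonneg (u a - u b)]
    have hlim : ∀ y ∈ ball x (r / 2), ∃ L, Tendsto (fun k => fderiv ℂ (holo (u k)) y) atTop (𝓝 L) :=
      fun y hy => cauchySeq_tendsto_of_complete (hunif.cauchySeq hy)
    choose! g' hg' using hlim
    have hu' := hunif.tendstoUniformlyOn_of_tendsto hg'
    exact (hasFDerivAt_of_tendstoUniformlyOn isOpen_ball hu'
      (fun k y hy => (hda k y (hsub hy)).hasFDerivAt) (fun y hy => hg y (hsub hy))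
      (mem_ball_self (by positivity))).differentiableAt.differentiableWithinAt
  refine ⟨g, hgd, ?_⟩
  obtain ⟨ns, hns, hae⟩ := (tendstoInMeasure_of_tendsto_Lp hf).exists_seq_tendsto_ae
  have hall : ∀ᵐ x ∂(volume.restrict (Ω : Set (Fin n → ℂ))), ∀ k, F k x = holo (u k) x :=
    ae_all_iff.2 fun k => coeFn_ae_eq_holo (u k)
  filter_upwards [hae, hall, ae_restrict_mem Ω.isOpen.measurableSet] with x h1 h2 h3
  simp only [h2] at h1
  exact tendsto_nhds_unique h1 ((hg x h3).comp hns.tendsto_atTop)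

instance instCompleteSpaceBergmanSpace {n : ℕ} (Ω : Opens (Fin n → ℂ)) :
    CompleteSpace (bergmanSpace Ω) :=
  (isClosed_bergmanSpace Ω).completeSpace_coe

/-- Evaluation at a point of `Ω`, as a bounded linear functional on `A²(Ω)`. -/
def evalCLM {n : ℕ} {Ω : Opens (Fin n → ℂ)} (z : Ω) : bergmanSpace Ω →L[ℂ] ℂ :=
  LinearMap.mkContinuousOfExistsBound
    { toFun := fun f => holo f z
      map_add' := fun f g => holo_add f g z.2
      map_smul' := fun c f => holo_smul c f z.2 }
    (by
      obtain ⟨r, hr, hxr⟩ := Metric.nhds_basis_closedBall.mem_iff.1 (Ω.isOpen.mem_nhds z.2)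
      obtain ⟨C, hC⟩ := exists_norm_holo_le n hr
      exact ⟨C, fun f => hC Ω f z hxr⟩)

/-- `A²(Ω)` is a reproducing kernel Hilbert space of functions on `Ω`: an element `f` is regarded as
the function `z ↦ holo f z`. -/
instance instRKHSBergmanSpace {n : ℕ} (Ω : Opens (Fin n → ℂ)) : RKHS ℂ (bergmanSpace Ω) Ω ℂ where
  coeCLM := ContinuousLinearMap.pi fun z => evalCLM z
  coeCLM_injective := by
    intro f g hfg
    refine Subtype.ext (Lp.ext ?_)
    filter_upwards [coeFn_ae_eq_holo f, coeFn_ae_eq_holo g,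
      ae_restrict_mem Ω.isOpen.measurableSet] with x h1 h2 h3
    rw [h1, h2]
    exact congrFun hfg ⟨x, h3⟩

theorem bergmanSpace_apply {n : ℕ} {Ω : Opens (Fin n → ℂ)} (f : bergmanSpace Ω) (z : Ω) :
    f z = holo f z := rfl

/-! ### Bergman kernel, Toeplitz operators, Berezin transform -/

/-- The function `K_z = K(·, z) ∈ A²(Ω)`, i.e. the element representing evaluation at `z`. -/
def kernelAt {n : ℕ} (Ω : Opens (Fin n → ℂ)) (z : Ω) : bergmanSpace Ω :=
  RKHS.kerFun (bergmanSpace Ω) z 1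

/-- The Bergman kernel `K(w, z) = K_z(w)` of `Ω`. -/
def bergmanKernel {n : ℕ} (Ω : Opens (Fin n → ℂ)) (w z : Ω) : ℂ :=
  kernelAt Ω z w

/-- The reproducing property `f(z) = ⟨f, K_z⟩`. (Mathlib's inner product is linear in the second
variable.) -/
theorem inner_kernelAt {n : ℕ} (Ω : Opens (Fin n → ℂ)) (z : Ω) (f : bergmanSpace Ω) :
    inner ℂ (kernelAt Ω z) f = f z := by
  simp [kernelAt]

/-- The zero set of the Bergman kernel on the diagonal. -/
def zeroSet {n : ℕ} (Ω : Opens (Fin n → ℂ)) : Set (Fin n → ℂ) :=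
  {z | ∃ h : z ∈ Ω, bergmanKernel Ω ⟨z, h⟩ ⟨z, h⟩ = 0}

/-- A non-trivial Bergman domain: a domain (non-empty connected open set) with `A²(Ω) ≠ {0}`. -/
def IsNontrivialBergmanDomain {n : ℕ} (Ω : Opens (Fin n → ℂ)) : Prop :=
  IsConnected (Ω : Set (Fin n → ℂ)) ∧ bergmanSpace Ω ≠ ⊥

/-- The normalized Bergman kernel `k_z = K_z / √K(z, z)`, meaningful where `K(z, z) ≠ 0`. (The number
`K(z, z)` is real and non-negative.) -/
def normalizedKernel {n : ℕ} (Ω : Opens (Fin n → ℂ)) (z : Ω) : bergmanSpace Ω :=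
  ((√(bergmanKernel Ω z z).re : ℝ) : ℂ)⁻¹ • kernelAt Ω z

/-- The Berezin transform `B_Ω T (z) = ⟨T k_z, k_z⟩` of a bounded operator on `A²(Ω)`. -/
def berezin {n : ℕ} (Ω : Opens (Fin n → ℂ)) (T : bergmanSpace Ω →L[ℂ] bergmanSpace Ω) (z : Ω) : ℂ :=
  inner ℂ (normalizedKernel Ω z) (T (normalizedKernel Ω z))

/-- The space `L^∞(Ω)` of bounded symbols. -/
abbrev Symbol {n : ℕ} (Ω : Opens (Fin n → ℂ)) : Type :=
  Lp ℂ ∞ (volume.restrict (Ω : Set (Fin n → ℂ)))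

/-- The restriction of a bounded symbol to a smaller open set. -/
def Symbol.restrict {n : ℕ} {U Ω : Opens (Fin n → ℂ)} (h : U ≤ Ω) (φ : Symbol Ω) : Symbol U :=
  ((Lp.memLp φ).mono_measure (Measure.restrict_mono h le_rfl)).toLp φ

/-- The Toeplitz operator `T_φ f = P_Ω (φ f)` on `A²(Ω)`, where `P_Ω` is the Bergman projection, the
orthogonal projection of `L²(Ω)` onto `A²(Ω)`. -/
def toeplitz {n : ℕ} (Ω : Opens (Fin n → ℂ)) (φ : Symbol Ω) : bergmanSpace Ω →L[ℂ] bergmanSpace Ω :=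
  (bergmanSpace Ω).orthogonalProjectionOnto ∘L
    (ContinuousLinearMap.mul ℂ ℂ).holderL (volume.restrict (Ω : Set (Fin n → ℂ))) ∞ 2 2 φ ∘L
      (bergmanSpace Ω).subtypeL

/-- The finite sum of finite products `∑ₘ T_{φ_{m,1}} ⋯ T_{φ_{m,kₘ}}` of Toeplitz operators. -/
def toeplitzSum {n l : ℕ} {k : Fin l → ℕ} (Ω : Opens (Fin n → ℂ))
    (φ : (m : Fin l) → Fin (k m) → Symbol Ω) : bergmanSpace Ω →L[ℂ] bergmanSpace Ω :=
  ∑ m, (List.ofFn fun i => toeplitz Ω (φ m i)).prod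

/-- The extension `E f` by zero to `ℂⁿ` of a function `f` on `Ω`. -/
def zeroExtend {n : ℕ} (Ω : Opens (Fin n → ℂ)) (f : Ω → ℂ) : (Fin n → ℂ) → ℂ :=
  Function.extend Subtype.val f 0

end Bergman

end

/-! The operators on the varying spaces `A²(D j)` are all transported into the fixed Hilbert space
`L²(Ω)`. For `U ⊆ V`, extension by zero is an isometry, but the extended spaces are not nested. They
are therefore enlarged to `holoOn`, the functions in `L²(V)` that are holomorphic on `U` and
arbitrary off `U`. The projection `Q` onto `holoOn` agrees with the Bergman projection of `U` on
extensions by zero. Hence extension by zero intertwines `T_φ` on `A²(U)` with `Q M_φ` on `L²(V)`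
(`extendL_toeplitz`), and likewise for sums of products (`extendL_toeplitzSum`).

Along an exhaustion the spaces `holoOn` decrease, and their intersection consists of the functions
holomorphic on `Ω` (`iInf_holoOn`). So their projections `Q j` converge strongly to that onto
`A²(Ω)`, and so do sums of products with the fixed multiplications.

The kernels fit the same picture: `Q j` maps the extended kernel of a smaller set to that of `D j`
(`starProjection_extendL_kernelAt`). Fix `D i` containing `z`, and let `κ w` be the extended kernel
of `D i`. For `w` near `z` and `j ≥ i`, the Berezin transform on `D j` is `⟨q, S q⟩ / ⟨q, q⟩` with
`q = Q j (κ w)` and `S` the transported operator. Since `κ` is continuous, this converges jointly in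
`(j, w)` wherever the limiting kernel is nonzero, which gives uniform convergence on compact sets.

For bounded `Ω`, the Berezin transforms are bounded uniformly in `j`, and `𝒵` is a null set because
it lies in the zeros of a nonzero holomorphic function. Dominated convergence concludes. -/

noncomputable section

namespace Bergman

/-! ### Restriction and extension by zero -/

/-- Restriction of square integrable functions to a smaller open set. -/
def restrictL {n : ℕ} {U V : Opens (Fin n → ℂ)} (h : U ≤ V) :
    Lp ℂ 2 (volume.restrict (V : Set (Fin n → ℂ))) →L[ℂ]
      Lp ℂ 2 (volume.restrict (U : Set (Fin n → ℂ))) :=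
  LinearMap.mkContinuous
    { toFun := fun f => ((Lp.memLp f).mono_measure (Measure.restrict_mono h le_rfl)).toLp f
      map_add' := fun f g => by
        rw [← MemLp.toLp_add]
        exact MemLp.toLp_congr _ _
          (ae_mono (Measure.restrict_mono h le_rfl) (Lp.coeFn_add f g))
      map_smul' := fun c f => by
        rw [RingHom.id_apply, ← MemLp.toLp_const_smul]
        exact MemLp.toLp_congr _ _
          (ae_mono (Measure.restrict_mono h le_rfl) (Lp.coeFn_smul c f)) } 1
    (fun f => by
      rw [one_mul]
      change ‖((Lp.memLp f).mono_measure (Measure.restrict_mono h le_rfl)).toLp f‖ ≤ ‖f‖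
      rw [Lp.norm_toLp, Lp.norm_def]
      exact ENNReal.toReal_mono (Lp.eLpNorm_ne_top f)
        (eLpNorm_mono_measure _ (Measure.restrict_mono h le_rfl)))

theorem coeFn_restrictL {n : ℕ} {U V : Opens (Fin n → ℂ)} (h : U ≤ V)
    (f : Lp ℂ 2 (volume.restrict (V : Set (Fin n → ℂ)))) :
    restrictL h f =ᵐ[volume.restrict (U : Set (Fin n → ℂ))] f :=
  MemLp.coeFn_toLp ((Lp.memLp f).mono_measure (Measure.restrict_mono h le_rfl))

theorem coeFn_symbolRestrict {n : ℕ} {U V : Opens (Fin n → ℂ)} (h : U ≤ V) (φ : Symbol V) :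
    φ.restrict h =ᵐ[volume.restrict (U : Set (Fin n → ℂ))] φ :=
  MemLp.coeFn_toLp _

/-- Extension of square integrable functions by zero, as the adjoint of restriction. -/
def extendL {n : ℕ} {U V : Opens (Fin n → ℂ)} (h : U ≤ V) :
    Lp ℂ 2 (volume.restrict (U : Set (Fin n → ℂ))) →L[ℂ]
      Lp ℂ 2 (volume.restrict (V : Set (Fin n → ℂ))) :=
  (restrictL h).adjoint

theorem inner_extendL {n : ℕ} {U V : Opens (Fin n → ℂ)} (h : U ≤ V)
    (g : Lp ℂ 2 (volume.restrict (U : Set (Fin n → ℂ))))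
    (f : Lp ℂ 2 (volume.restrict (V : Set (Fin n → ℂ)))) :
    inner ℂ (extendL h g) f = inner ℂ g (restrictL h f) :=
  ContinuousLinearMap.adjoint_inner_left _ _ _

theorem coeFn_extendL {n : ℕ} {U V : Opens (Fin n → ℂ)} (h : U ≤ V)
    (g : Lp ℂ 2 (volume.restrict (U : Set (Fin n → ℂ)))) :
    extendL h g =ᵐ[volume.restrict (V : Set (Fin n → ℂ))]
      (U : Set (Fin n → ℂ)).indicator g := by
  have hU : MeasurableSet (U : Set (Fin n → ℂ)) := U.isOpen.measurableSet
  have hres : (volume.restrict (V : Set (Fin n → ℂ))).restrict (U : Set (Fin n → ℂ))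
      = volume.restrict (U : Set (Fin n → ℂ)) := by
    rw [Measure.restrict_restrict hU, Set.inter_eq_left.2 h]
  have hg : MemLp ((U : Set (Fin n → ℂ)).indicator g) 2
      (volume.restrict (V : Set (Fin n → ℂ))) := by
    rw [memLp_indicator_iff_restrict hU, hres]
    exact Lp.memLp g
  -- The adjoint is identified by pairing with an arbitrary `f`: an integral over `U` is the
  -- integral over `V` of the indicator.
  have : extendL h g = hg.toLp _ := by
    refine ext_inner_right ℂ fun f => ?_
    rw [inner_extendL, L2.inner_def, L2.inner_def]
    have hint : ∀ F : (Fin n → ℂ) → ℂ, ∫ x in (U : Set (Fin n → ℂ)), F x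
        = ∫ x in (V : Set (Fin n → ℂ)), (U : Set (Fin n → ℂ)).indicator F x := fun F => by
      rw [integral_indicator hU, hres]
    rw [hint]
    refine integral_congr_ae ?_
    have h1 := (ae_restrict_iff' (μ := volume.restrict (V : Set (Fin n → ℂ))) hU).1
      (by rw [hres]; exact coeFn_restrictL h f)
    filter_upwards [h1, hg.coeFn_toLp] with x hx1 hx2
    rw [hx2]
    by_cases hx : x ∈ (U : Set (Fin n → ℂ))
    · rw [Set.indicator_of_mem hx, Set.indicator_of_mem hx, hx1 hx]
    · rw [Set.indicator_of_notMem hx, Set.indicator_of_notMem hx, inner_zero_left]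
  rw [this]
  exact hg.coeFn_toLp

theorem restrictL_extendL {n : ℕ} {U V : Opens (Fin n → ℂ)} (h : U ≤ V)
    (g : Lp ℂ 2 (volume.restrict (U : Set (Fin n → ℂ)))) :
    restrictL h (extendL h g) = g := by
  refine Lp.ext ?_
  filter_upwards [coeFn_restrictL h (extendL h g),
    ae_mono (Measure.restrict_mono h le_rfl) (coeFn_extendL h g),
    ae_restrict_mem U.isOpen.measurableSet] with x h1 h2 h3
  rw [h1, h2, Set.indicator_of_mem h3]

theorem inner_extendL_extendL {n : ℕ} {U V : Opens (Fin n → ℂ)} (h : U ≤ V)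
    (f g : Lp ℂ 2 (volume.restrict (U : Set (Fin n → ℂ)))) :
    inner ℂ (extendL h f) (extendL h g) = inner ℂ f g := by
  rw [inner_extendL, restrictL_extendL]

theorem restrictL_restrictL {n : ℕ} {U V W : Opens (Fin n → ℂ)} (h : U ≤ V) (h' : V ≤ W)
    (f : Lp ℂ 2 (volume.restrict (W : Set (Fin n → ℂ)))) :
    restrictL h (restrictL h' f) = restrictL (h.trans h') f := by
  refine Lp.ext ?_
  filter_upwards [coeFn_restrictL h (restrictL h' f), coeFn_restrictL (h.trans h') f,
    ae_mono (Measure.restrict_mono h le_rfl) (coeFn_restrictL h' f)] with x h1 h2 h3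
  rw [h1, h2, h3]

/-- Multiplication by a bounded symbol. -/
def mulL {n : ℕ} {U : Opens (Fin n → ℂ)} (φ : Symbol U) :
    Lp ℂ 2 (volume.restrict (U : Set (Fin n → ℂ))) →L[ℂ]
      Lp ℂ 2 (volume.restrict (U : Set (Fin n → ℂ))) :=
  (ContinuousLinearMap.mul ℂ ℂ).holderL (volume.restrict (U : Set (Fin n → ℂ))) ∞ 2 2 φ

theorem coeFn_mulL {n : ℕ} {U : Opens (Fin n → ℂ)} (φ : Symbol U)
    (f : Lp ℂ 2 (volume.restrict (U : Set (Fin n → ℂ)))) :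
    mulL φ f =ᵐ[volume.restrict (U : Set (Fin n → ℂ))] fun x => φ x * f x :=
  ContinuousLinearMap.coeFn_holder (r := 2) (ContinuousLinearMap.mul ℂ ℂ) φ f

theorem norm_mulL_le {n : ℕ} {U : Opens (Fin n → ℂ)} (φ : Symbol U) : ‖mulL φ‖ ≤ ‖φ‖ := by
  refine ContinuousLinearMap.opNorm_le_bound _ (norm_nonneg _) fun f => ?_
  refine (ContinuousLinearMap.norm_holder_apply_apply_le (r := 2)
    (ContinuousLinearMap.mul ℂ ℂ) φ f).trans ?_
  gcongr
  exact mul_le_of_le_one_left (norm_nonneg _) (ContinuousLinearMap.opNorm_mul_le ℂ ℂ)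

theorem norm_symbolRestrict_le {n : ℕ} {U V : Opens (Fin n → ℂ)} (h : U ≤ V) (φ : Symbol V) :
    ‖φ.restrict h‖ ≤ ‖φ‖ := by
  rw [Symbol.restrict, Lp.norm_toLp, Lp.norm_def]
  exact ENNReal.toReal_mono (Lp.eLpNorm_ne_top φ)
    (eLpNorm_mono_measure _ (Measure.restrict_mono h le_rfl))

theorem symbolRestrict_le_rfl {n : ℕ} {U : Opens (Fin n → ℂ)} (φ : Symbol U) :
    φ.restrict le_rfl = φ :=
  Lp.ext (coeFn_symbolRestrict le_rfl φ)

/-- Off `U` both sides vanish, so the values of `φ` there are irrelevant. Thus one multiplication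
operator on `L²(V)` serves every smaller set. -/
theorem extendL_mulL {n : ℕ} {U V : Opens (Fin n → ℂ)} (h : U ≤ V) (φ : Symbol V)
    (g : Lp ℂ 2 (volume.restrict (U : Set (Fin n → ℂ)))) :
    extendL h (mulL (φ.restrict h) g) = mulL φ (extendL h g) := by
  refine Lp.ext ?_
  have hae : ∀ᵐ x ∂(volume.restrict (U : Set (Fin n → ℂ))),
      mulL (φ.restrict h) g x = φ x * g x := by
    filter_upwards [coeFn_mulL (φ.restrict h) g, coeFn_symbolRestrict h φ] with x h1 h2
    rw [h1, h2]
  have hae' := ae_restrict_of_ae (s := (V : Set (Fin n → ℂ)))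
    ((ae_restrict_iff' U.isOpen.measurableSet).1 hae)
  filter_upwards [coeFn_extendL h (mulL (φ.restrict h) g), coeFn_mulL φ (extendL h g),
    coeFn_extendL h g, hae'] with x h1 h2 h3 h4
  rw [h1, h2, h3]
  by_cases hx : x ∈ (U : Set (Fin n → ℂ))
  · rw [Set.indicator_of_mem hx, Set.indicator_of_mem hx, h4 hx]
  · rw [Set.indicator_of_notMem hx, Set.indicator_of_notMem hx, mul_zero]

/-! ### Functions in `L²(V)` that are holomorphic on a smaller open set -/

/-- The functions in `L²(V)` whose restriction to `U` is holomorphic. -/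
def holoOn {n : ℕ} {U V : Opens (Fin n → ℂ)} (h : U ≤ V) :
    Submodule ℂ (Lp ℂ 2 (volume.restrict (V : Set (Fin n → ℂ)))) :=
  (bergmanSpace U).comap (restrictL h).toLinearMap

theorem mem_holoOn {n : ℕ} {U V : Opens (Fin n → ℂ)} {h : U ≤ V}
    {f : Lp ℂ 2 (volume.restrict (V : Set (Fin n → ℂ)))} :
    f ∈ holoOn h ↔ restrictL h f ∈ bergmanSpace U := by
  rw [holoOn, Submodule.mem_comap, ContinuousLinearMap.coe_coe]

theorem isClosed_holoOn {n : ℕ} {U V : Opens (Fin n → ℂ)} (h : U ≤ V) :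
    IsClosed (holoOn h : Set (Lp ℂ 2 (volume.restrict (V : Set (Fin n → ℂ))))) :=
  (isClosed_bergmanSpace U).preimage (restrictL h).continuous

instance instCompleteSpaceHoloOn {n : ℕ} {U V : Opens (Fin n → ℂ)} (h : U ≤ V) :
    CompleteSpace (holoOn h) :=
  (isClosed_holoOn h).completeSpace_coe

theorem restrictL_mem_bergmanSpace {n : ℕ} {U V : Opens (Fin n → ℂ)} (h : U ≤ V)
    {f : Lp ℂ 2 (volume.restrict (V : Set (Fin n → ℂ)))} (hf : f ∈ bergmanSpace V) :
    restrictL h f ∈ bergmanSpace U := by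
  obtain ⟨g, hg, hfg⟩ := hf
  exact ⟨g, hg.mono h, (coeFn_restrictL h f).trans
    (ae_mono (Measure.restrict_mono h le_rfl) hfg)⟩

/-- Holomorphy on a larger set is a stronger condition. This nesting is what allowing arbitrary
values off the smaller set achieves. -/
theorem holoOn_anti {n : ℕ} {U V W : Opens (Fin n → ℂ)} (h : U ≤ V) (h' : V ≤ W) :
    holoOn h' ≤ holoOn (h.trans h') := fun f hf => by
  rw [mem_holoOn, ← restrictL_restrictL h h']
  exact restrictL_mem_bergmanSpace h (mem_holoOn.1 hf)

theorem extendL_mem_holoOn {n : ℕ} {U V : Opens (Fin n → ℂ)} (h : U ≤ V)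
    (g : bergmanSpace U) : extendL h g ∈ holoOn h := by
  rw [mem_holoOn, restrictL_extendL]
  exact g.2

/-- The value at `w ∈ U` does not change under restriction. -/
theorem holo_restrictL {n : ℕ} {U V : Opens (Fin n → ℂ)} (h : U ≤ V) (f : bergmanSpace V) :
    Set.EqOn (holo (⟨restrictL h f, restrictL_mem_bergmanSpace h f.2⟩ : bergmanSpace U))
      (holo f) U :=
  eqOn_holo _ ((differentiableOn_holo f).mono h)
    ((coeFn_restrictL h _).trans (ae_mono (Measure.restrict_mono h le_rfl) (coeFn_ae_eq_holo f)))

/-- The projection of an extension by zero is the extension by zero of the Bergman projection. -/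
theorem starProjection_extendL {n : ℕ} {U V : Opens (Fin n → ℂ)} (h : U ≤ V)
    (x : Lp ℂ 2 (volume.restrict (U : Set (Fin n → ℂ)))) :
    (holoOn h).starProjection (extendL h x)
      = extendL h ((bergmanSpace U).orthogonalProjectionOnto x) := by
  refine Submodule.eq_starProjection_of_mem_of_inner_eq_zero (extendL_mem_holoOn h _)
    fun f hf => ?_
  -- Only the restriction of `f` to `U` matters, and it lies in `A²(U)`, to which the residual of
  -- the Bergman projection is orthogonal.
  rw [← map_sub, inner_extendL]
  exact Submodule.starProjection_inner_eq_zero x _ (mem_holoOn.1 hf)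

theorem extendL_toeplitz {n : ℕ} {U V : Opens (Fin n → ℂ)} (h : U ≤ V) (φ : Symbol V)
    (g : bergmanSpace U) :
    extendL h (toeplitz U (φ.restrict h) g)
      = (holoOn h).starProjection (mulL φ (extendL h g)) := by
  rw [← extendL_mulL, starProjection_extendL]
  rfl

theorem inner_extendL_kernelAt {n : ℕ} {U V : Opens (Fin n → ℂ)} (h : U ≤ V) (w : U)
    (f : Lp ℂ 2 (volume.restrict (V : Set (Fin n → ℂ)))) (hf : f ∈ holoOn h) :
    inner ℂ (extendL h (kernelAt U w)) f = holo (⟨restrictL h f, mem_holoOn.1 hf⟩ : bergmanSpace U) w := by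
  rw [inner_extendL]
  exact inner_kernelAt U w ⟨restrictL h f, mem_holoOn.1 hf⟩

/-- Against functions holomorphic on `V`, both extended kernels represent evaluation at `w`, and the
one from `V` already lies in `holoOn h'`. -/
theorem starProjection_extendL_kernelAt {n : ℕ} {U V W : Opens (Fin n → ℂ)} (h : U ≤ V)
    (h' : V ≤ W) (w : U) :
    (holoOn h').starProjection (extendL (h.trans h') (kernelAt U w))
      = extendL h' (kernelAt V ⟨w, h w.2⟩) := by
  refine Submodule.eq_starProjection_of_mem_of_inner_eq_zero (extendL_mem_holoOn h' _)
    fun f hf => ?_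
  rw [inner_sub_left, inner_extendL_kernelAt h' _ f hf,
    inner_extendL_kernelAt (h.trans h') _ f (holoOn_anti h h' hf), sub_eq_zero]
  have := holo_restrictL h ⟨restrictL h' f, mem_holoOn.1 hf⟩ w.2
  simp only [restrictL_restrictL] at this
  exact this

attribute [local instance 2000] InnerProductSpace.toInner

/-! ### Strong convergence -/

/-- Joint convergence `A j x' → A∞ x` as `j → ∞` and `x' → x`; for linear operators between Banach
spaces this amounts to strong convergence. -/
def StrongTendsto {E : Type*} [TopologicalSpace E] (A : ℕ → E → E) (A' : E → E) : Prop :=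
  ∀ x, Tendsto (fun p : ℕ × E => A p.1 p.2) (atTop ×ˢ 𝓝 x) (𝓝 (A' x))

/-- With the limit taken jointly, products pass to the limit without any separate appeal to uniform
boundedness. -/
theorem StrongTendsto.comp {E : Type*} [TopologicalSpace E] {A B : ℕ → E → E} {A' B' : E → E}
    (hA : StrongTendsto A A') (hB : StrongTendsto B B') :
    StrongTendsto (fun j x => A j (B j x)) (fun x => A' (B' x)) := fun x =>
  (hA (B' x)).comp (tendsto_fst.prodMk (hB x))

theorem strongTendsto_const {E : Type*} [TopologicalSpace E] {A : E → E} (hA : Continuous A) :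
    StrongTendsto (fun _ => A) A := fun x =>
  (hA.tendsto x).comp tendsto_snd

theorem StrongTendsto.sum {E ι : Type*} [TopologicalSpace E] [AddCommMonoid E] [ContinuousAdd E]
    (s : Finset ι) {A : ι → ℕ → E → E} {A' : ι → E → E}
    (hA : ∀ i ∈ s, StrongTendsto (A i) (A' i)) :
    StrongTendsto (fun j x => ∑ i ∈ s, A i j x) (fun x => ∑ i ∈ s, A' i x) := fun x =>
  tendsto_finsetSum s fun i hi => hA i hi x

theorem StrongTendsto.list_prod {E ι : Type*} [NormedAddCommGroup E] [NormedSpace ℂ E]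
    {A : ι → ℕ → E →L[ℂ] E} {A' : ι → E →L[ℂ] E}
    (hA : ∀ i, StrongTendsto (fun j x => A i j x) (fun x => A' i x)) (L : List ι) :
    StrongTendsto (fun j x => (L.map fun i => A i j).prod x) (fun x => (L.map A').prod x) := by
  induction L with
  | nil => simpa using strongTendsto_const (A := fun x : E => x) continuous_id
  | cons a L ih => simpa using (hA a).comp ih

theorem strongTendsto_of_norm_le_one {E : Type*} [NormedAddCommGroup E] [NormedSpace ℂ E]
    {A : ℕ → E →L[ℂ] E} {A' : E →L[ℂ] E} (hA : ∀ j, ‖A j‖ ≤ 1)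
    (h : ∀ x, Tendsto (fun j => A j x) atTop (𝓝 (A' x))) :
    StrongTendsto (fun j x => A j x) (fun x => A' x) := by
  intro x
  -- Split `A j y = A j (y - x) + A j x`; the contraction bound controls the first term uniformly in
  -- `j`.
  have h1 : Tendsto (fun p : ℕ × E => A p.1 (p.2 - x)) (atTop ×ˢ 𝓝 x) (𝓝 0) := by
    refine squeeze_zero_norm (a := fun p : ℕ × E => ‖p.2 - x‖) (fun p => ?_) ?_
    · exact ((A p.1).le_opNorm _).trans (mul_le_of_le_one_left (norm_nonneg _) (hA p.1))
    · have : Tendsto (fun p : ℕ × E => ‖p.2 - x‖) (atTop ×ˢ 𝓝 x) (𝓝 ‖x - x‖) :=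
        ((tendsto_snd (f := atTop) (g := 𝓝 x)).sub_const x).norm
      simpa using this
  have h2 := h1.add ((h x).comp (tendsto_fst (f := atTop) (g := 𝓝 x)))
  simpa using h2

/-- Pass to complements: the `(N j)ᗮ` increase, the closure of their union is `Mᗮ`, and the result
for increasing families applies. -/
theorem tendsto_starProjection_iInf {E : Type*} [NormedAddCommGroup E] [InnerProductSpace ℂ E]
    [CompleteSpace E] (N : ℕ → Submodule ℂ E) [∀ j, (N j).HasOrthogonalProjection]
    (M : Submodule ℂ E) [M.HasOrthogonalProjection] (hN : Antitone N) (hM : ⨅ j, N j = M) (x : E) :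
    Tendsto (fun j => (N j).starProjection x) atTop (𝓝 (M.starProjection x)) := by
  have hU : Monotone fun j => (N j)ᗮ := fun i j hij => Submodule.orthogonal_le (hN hij)
  have h := Submodule.starProjection_tendsto_closure_iSup (fun j => (N j)ᗮ) hU x
  have hcl : (⨆ j, (N j)ᗮ).topologicalClosure = Mᗮ := by
    rw [← Submodule.orthogonal_orthogonal_eq_closure, ← Submodule.iInf_orthogonal]
    simp only [Submodule.orthogonal_orthogonal, hM]
  have h' := (tendsto_const_nhds (x := x)).sub h
  simp only [hcl, Submodule.starProjection_orthogonal_val, sub_sub_cancel] at h'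
  exact h'

/-! ### Exhaustions -/

/-- The holomorphic representatives on the `D j` agree almost everywhere on overlaps, hence
everywhere by continuity, and so glue to one on `Ω`. -/
theorem iInf_holoOn {n : ℕ} {Ω : Opens (Fin n → ℂ)} {D : ℕ → Opens (Fin n → ℂ)}
    (hmono : Monotone D) (hle : ∀ j, D j ≤ Ω)
    (hunion : (⋃ j, (D j : Set (Fin n → ℂ))) = (Ω : Set (Fin n → ℂ))) :
    ⨅ j, holoOn (hle j) = holoOn (le_refl Ω) := by
  refine le_antisymm (fun f hf => ?_) (le_iInf fun j => holoOn_anti (hle j) le_rfl)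
  have hf' : ∀ j, ∃ g : (Fin n → ℂ) → ℂ, DifferentiableOn ℂ g (D j) ∧
      f =ᵐ[volume.restrict (D j : Set (Fin n → ℂ))] g := fun j => by
    obtain ⟨g, hg, hfg⟩ := mem_holoOn.1 ((Submodule.mem_iInf _).1 hf j)
    exact ⟨g, hg, (coeFn_restrictL (hle j) f).symm.trans hfg⟩
  choose g hg hfg using hf'
  have hcompat : ∀ i j, i ≤ j → Set.EqOn (g j) (g i) (D i) := fun i j hij =>
    Measure.eqOn_open_of_ae_eq
      (((hfg j).filter_mono (ae_mono (Measure.restrict_mono (hmono hij) le_rfl))).symm.trans (hfg i))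
      (D i).isOpen ((hg j).continuousOn.mono (hmono hij)) (hg i).continuousOn
  have hex : ∀ x ∈ (Ω : Set (Fin n → ℂ)), ∃ j, x ∈ D j := fun x hx => by
    rw [← hunion] at hx
    simpa using hx
  choose! a ha using hex
  set G : (Fin n → ℂ) → ℂ := fun x => g (a x) x with hG
  have hGeq : ∀ j, Set.EqOn G (g j) (D j) := fun j x hx => by
    have hxa := ha x (hle j hx)
    rcases le_total (a x) j with h | h
    · exact (hcompat _ _ h hxa).symm
    · exact hcompat _ _ h hx
  have hGd : DifferentiableOn ℂ G Ω := fun x hx => by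
    have hxa := ha x hx
    have h1 := ((hg (a x)).congr (hGeq (a x))) x hxa
    exact (h1.differentiableAt ((D (a x)).isOpen.mem_nhds hxa)).differentiableWithinAt
  have hGf : f =ᵐ[volume.restrict (Ω : Set (Fin n → ℂ))] G := by
    have hae : ae (volume.restrict (Ω : Set (Fin n → ℂ)))
        = ⨆ j, ae (volume.restrict (D j : Set (Fin n → ℂ))) := by
      rw [← hunion, ae_restrict_iUnion_eq]
    rw [Filter.EventuallyEq, hae, Filter.eventually_iSup]
    intro j
    filter_upwards [hfg j, ae_restrict_mem (D j).isOpen.measurableSet] with x h1 h2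
    rw [h1, hGeq j h2]
  exact mem_holoOn.2 ⟨G, hGd, (coeFn_restrictL le_rfl f).trans hGf⟩

/-! ### Sums of products of Toeplitz operators, transported to `L²(V)` -/

/-- The operator on `L²(V)` that corresponds to `∑ₘ T_{φ_{m,1}} ⋯ T_{φ_{m,kₘ}}` on `A²(U)`. -/
def liftedSum {n l : ℕ} {k : Fin l → ℕ} {U V : Opens (Fin n → ℂ)} (h : U ≤ V)
    (φ : (m : Fin l) → Fin (k m) → Symbol V) :
    Lp ℂ 2 (volume.restrict (V : Set (Fin n → ℂ))) →L[ℂ]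
      Lp ℂ 2 (volume.restrict (V : Set (Fin n → ℂ))) :=
  ∑ m, ((List.ofFn (φ m)).map fun ψ => (holoOn h).starProjection ∘L mulL ψ).prod

theorem extendL_list_prod {n : ℕ} {U V : Opens (Fin n → ℂ)} (h : U ≤ V) (L : List (Symbol V))
    (g : bergmanSpace U) :
    extendL h ((L.map fun ψ => toeplitz U (ψ.restrict h)).prod g)
      = (L.map fun ψ => (holoOn h).starProjection ∘L mulL ψ).prod (extendL h g) := by
  induction L generalizing g with
  | nil => simp
  | cons a L ih =>
    simp only [List.map_cons, List.prod_cons]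
    change extendL h (toeplitz U (a.restrict h)
      ((L.map fun ψ => toeplitz U (ψ.restrict h)).prod g)) = _
    rw [extendL_toeplitz, ih]
    rfl

theorem toeplitzSum_apply {n l : ℕ} {k : Fin l → ℕ} {U V : Opens (Fin n → ℂ)} (h : U ≤ V)
    (φ : (m : Fin l) → Fin (k m) → Symbol V) :
    toeplitzSum U (fun m i => (φ m i).restrict h)
      = ∑ m, ((List.ofFn (φ m)).map fun ψ => toeplitz U (ψ.restrict h)).prod := by
  simp only [toeplitzSum, List.map_ofFn, Function.comp_def]

theorem extendL_toeplitzSum {n l : ℕ} {k : Fin l → ℕ} {U V : Opens (Fin n → ℂ)} (h : U ≤ V)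
    (φ : (m : Fin l) → Fin (k m) → Symbol V) (g : bergmanSpace U) :
    extendL h (toeplitzSum U (fun m i => (φ m i).restrict h) g)
      = liftedSum h φ (extendL h g) := by
  rw [toeplitzSum_apply, liftedSum, _root_.sum_apply, _root_.sum_apply,
    Submodule.coe_sum, map_sum]
  exact Finset.sum_congr rfl fun m _ => extendL_list_prod h _ g

theorem strongTendsto_starProjection_holoOn {n : ℕ} {Ω : Opens (Fin n → ℂ)}
    {D : ℕ → Opens (Fin n → ℂ)} (hmono : Monotone D) (hle : ∀ j, D j ≤ Ω)
    (hunion : (⋃ j, (D j : Set (Fin n → ℂ))) = (Ω : Set (Fin n → ℂ))) :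
    StrongTendsto (fun j x => (holoOn (hle j)).starProjection x)
      (fun x => (holoOn (le_refl Ω)).starProjection x) :=
  strongTendsto_of_norm_le_one (fun _ => Submodule.starProjection_norm_le _) fun x =>
    tendsto_starProjection_iInf _ _ (fun _ _ hij => holoOn_anti (hmono hij) (hle _))
      (iInf_holoOn hmono hle hunion) x

theorem strongTendsto_liftedSum {n l : ℕ} {k : Fin l → ℕ} {Ω : Opens (Fin n → ℂ)}
    {D : ℕ → Opens (Fin n → ℂ)} (hmono : Monotone D) (hle : ∀ j, D j ≤ Ω)
    (hunion : (⋃ j, (D j : Set (Fin n → ℂ))) = (Ω : Set (Fin n → ℂ)))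
    (φ : (m : Fin l) → Fin (k m) → Symbol Ω) :
    StrongTendsto (fun j x => liftedSum (hle j) φ x)
      (fun x => liftedSum (le_refl Ω) φ x) := by
  simp only [liftedSum, _root_.sum_apply]
  refine StrongTendsto.sum _ fun m _ => ?_
  refine StrongTendsto.list_prod (A := fun ψ j => (holoOn (hle j)).starProjection ∘L mulL ψ)
    (A' := fun ψ => (holoOn (le_refl Ω)).starProjection ∘L mulL ψ) (fun ψ => ?_) _
  exact (strongTendsto_starProjection_holoOn hmono hle hunion).comp
    (strongTendsto_const (mulL ψ).continuous)

/-! ### The Berezin transform -/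

theorem inner_kernelAt_eq {n : ℕ} (Ω : Opens (Fin n → ℂ)) (z : Ω) (f : bergmanSpace Ω) :
    inner ℂ (kernelAt Ω z) f = f z :=
  inner_kernelAt Ω z f

theorem berezin_apply {n : ℕ} (Ω : Opens (Fin n → ℂ))
    (T : bergmanSpace Ω →L[ℂ] bergmanSpace Ω) (z : Ω) :
    berezin Ω T z = inner ℂ (normalizedKernel Ω z) (T (normalizedKernel Ω z)) :=
  rfl

theorem inner_kernelAt_self {n : ℕ} (Ω : Opens (Fin n → ℂ)) (z : Ω) :
    bergmanKernel Ω z z = ((‖kernelAt Ω z‖ ^ 2 : ℝ) : ℂ) := by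
  rw [bergmanKernel, ← inner_kernelAt_eq Ω z, inner_self_eq_norm_sq_to_K]
  norm_cast

theorem normalizedKernel_eq {n : ℕ} (Ω : Opens (Fin n → ℂ)) (z : Ω) :
    normalizedKernel Ω z = ((‖kernelAt Ω z‖ : ℝ) : ℂ)⁻¹ • kernelAt Ω z := by
  rw [normalizedKernel, inner_kernelAt_self, Complex.ofReal_re, Real.sqrt_sq (norm_nonneg _)]

/-- An inequality, because on the zero set the convention `0⁻¹ = 0` makes the normalized kernel
vanish. -/
theorem norm_normalizedKernel_le {n : ℕ} (Ω : Opens (Fin n → ℂ)) (z : Ω) :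
    ‖normalizedKernel Ω z‖ ≤ 1 := by
  rw [normalizedKernel_eq, norm_smul, norm_inv, Complex.norm_real, norm_norm]
  exact inv_mul_le_one

theorem inner_inv_norm_smul {H : Type*} [NormedAddCommGroup H] [InnerProductSpace ℂ H] (x y : H) :
    inner ℂ (((‖x‖ : ℝ) : ℂ)⁻¹ • x) (((‖x‖ : ℝ) : ℂ)⁻¹ • y) = inner ℂ x y / inner ℂ x x := by
  rw [inner_smul_left, inner_smul_right, inner_self_eq_norm_sq_to_K, map_inv₀, Complex.conj_ofReal,
    ← mul_assoc, ← sq, inv_pow, div_eq_inv_mul]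
  rfl

theorem berezin_eq {n : ℕ} (Ω : Opens (Fin n → ℂ)) (T : bergmanSpace Ω →L[ℂ] bergmanSpace Ω)
    (z : Ω) :
    berezin Ω T z = inner ℂ (kernelAt Ω z) (T (kernelAt Ω z))
      / inner ℂ (kernelAt Ω z) (kernelAt Ω z) := by
  rw [berezin_apply, normalizedKernel_eq, map_smul]
  exact inner_inv_norm_smul _ _

theorem norm_berezin_le {n : ℕ} (Ω : Opens (Fin n → ℂ))
    (T : bergmanSpace Ω →L[ℂ] bergmanSpace Ω) (z : Ω) : ‖berezin Ω T z‖ ≤ ‖T‖ := by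
  have h := norm_normalizedKernel_le Ω z
  calc ‖berezin Ω T z‖ ≤ ‖normalizedKernel Ω z‖ * ‖T (normalizedKernel Ω z)‖ := by
        rw [berezin_apply]
        exact norm_inner_le_norm (𝕜 := ℂ) _ _
    _ ≤ 1 * (‖T‖ * 1) := by
        gcongr
        exact (T.le_opNorm _).trans (by gcongr)
    _ = ‖T‖ := by ring

theorem zeroExtend_of_mem {n : ℕ} {Ω : Opens (Fin n → ℂ)} (f : Ω → ℂ) {z : Fin n → ℂ}
    (hz : z ∈ Ω) : zeroExtend Ω f z = f ⟨z, hz⟩ :=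
  Subtype.val_injective.extend_apply f 0 (⟨z, hz⟩ : Ω)

theorem zeroExtend_of_notMem {n : ℕ} {Ω : Opens (Fin n → ℂ)} (f : Ω → ℂ) {z : Fin n → ℂ}
    (hz : z ∉ Ω) : zeroExtend Ω f z = 0 :=
  Function.extend_apply' f (0 : (Fin n → ℂ) → ℂ) z fun ⟨a, ha⟩ => hz (ha ▸ a.2)

/-- The Berezin transform on `V`, expressed in `L²(W)` through the kernel of a smaller set `U`. -/
theorem zeroExtend_berezin {n l : ℕ} {k : Fin l → ℕ} {U V W : Opens (Fin n → ℂ)} (h : U ≤ V)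
    (h' : V ≤ W) (φ : (m : Fin l) → Fin (k m) → Symbol W) (w : U)
    (q : Lp ℂ 2 (volume.restrict (W : Set (Fin n → ℂ))))
    (hq : q = (holoOn h').starProjection (extendL (h.trans h') (kernelAt U w))) :
    zeroExtend V (berezin V (toeplitzSum V fun m i => (φ m i).restrict h')) w
      = inner ℂ q (liftedSum h' φ q) / inner ℂ q q := by
  rw [hq, zeroExtend_of_mem _ (h w.2), berezin_eq, starProjection_extendL_kernelAt h h',
    ← extendL_toeplitzSum, inner_extendL_extendL, inner_extendL_extendL]
  rfl

/-- For `f = K_w - K_z` the reproducing property gives `‖f‖² = f(w) - f(z)`. The interior derivative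
estimate bounds this by `C ‖f‖ ‖w - z‖`, and cancelling `‖f‖` leaves a local Lipschitz bound. -/
theorem continuous_kernelAt {n : ℕ} (Ω : Opens (Fin n → ℂ)) : Continuous (kernelAt Ω) := by
  rw [continuous_iff_continuousAt]
  intro z
  obtain ⟨r, hr, hzr⟩ := Metric.nhds_basis_closedBall.mem_iff.1 (Ω.isOpen.mem_nhds z.2)
  obtain ⟨C, hC⟩ := exists_norm_fderiv_holo_le n (r := r / 4) (by positivity)
  have hsub : ball (z : Fin n → ℂ) (r / 2) ⊆ (Ω : Set (Fin n → ℂ)) :=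
    (ball_subset_closedBall.trans (closedBall_subset_closedBall (by linarith))).trans hzr
  have hball : ∀ y ∈ ball (z : Fin n → ℂ) (r / 2),
      closedBall y (2 * (r / 4)) ⊆ (Ω : Set (Fin n → ℂ)) := by
    intro y hy
    refine (closedBall_subset_closedBall' ?_).trans hzr
    rw [mem_ball] at hy
    linarith
  have hlip : ∀ w : Ω, (w : Fin n → ℂ) ∈ ball (z : Fin n → ℂ) (r / 2) →
      ‖kernelAt Ω w - kernelAt Ω z‖ ≤ C * ‖(w : Fin n → ℂ) - z‖ := by
    intro w hw
    set f := kernelAt Ω w - kernelAt Ω z with hf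
    have h1 : ‖holo f w - holo f z‖ ≤ C * ‖f‖ * ‖(w : Fin n → ℂ) - z‖ :=
      (convex_ball (z : Fin n → ℂ) (r / 2)).norm_image_sub_le_of_norm_fderiv_le (𝕜 := ℂ)
        (fun y hy => (differentiableOn_holo f y (hsub hy)).differentiableAt
          (Ω.isOpen.mem_nhds (hsub hy)))
        (fun y hy => hC Ω f y (hball y hy)) (mem_ball_self (by positivity)) hw
    have h2 : inner ℂ f f = holo f w - holo f z := by
      nth_rw 1 [hf]
      rw [inner_sub_left, inner_kernelAt_eq, inner_kernelAt_eq]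
      rfl
    rw [← h2, inner_self_eq_norm_sq_to_K, norm_pow] at h1
    simp only [Complex.coe_algebraMap, Complex.norm_real, norm_norm] at h1
    rcases (norm_nonneg f).eq_or_lt with h0 | h0
    · rw [← h0]
      positivity
    · refine le_of_mul_le_mul_left ?_ h0
      linarith
  rw [ContinuousAt, tendsto_iff_norm_sub_tendsto_zero]
  have hev : ∀ᶠ w : Ω in 𝓝 z, (w : Fin n → ℂ) ∈ ball (z : Fin n → ℂ) (r / 2) :=
    continuous_subtype_val.continuousAt.eventually (ball_mem_nhds _ (by positivity))
  refine squeeze_zero' (.of_forall fun _ => norm_nonneg _) (hev.mono hlip) ?_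
  have hc : Continuous fun w : Ω => (C : ℝ) * ‖(w : Fin n → ℂ) - z‖ := by fun_prop
  simpa using hc.tendsto z

theorem mem_zeroSet_iff {n : ℕ} {Ω : Opens (Fin n → ℂ)} (z : Ω) :
    (z : Fin n → ℂ) ∈ zeroSet Ω ↔ kernelAt Ω z = 0 := by
  simp [zeroSet, inner_kernelAt_self]

/-- If evaluation at `z` vanishes on `A²(U)`, it vanishes on the restriction of `K^V_z`, so `K^V(z,
z) = 0`. -/
theorem mem_zeroSet_of_le {n : ℕ} {U V : Opens (Fin n → ℂ)} (h : U ≤ V) {z : Fin n → ℂ}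
    (hz : z ∈ zeroSet U) : z ∈ zeroSet V := by
  have hzU : z ∈ U := hz.1
  have h0 := (mem_zeroSet_iff (⟨z, hzU⟩ : U)).1 hz
  refine (mem_zeroSet_iff (⟨z, h hzU⟩ : V)).2 ?_
  have h1 := inner_kernelAt_eq V ⟨z, h hzU⟩ (kernelAt V ⟨z, h hzU⟩)
  have h2 := inner_kernelAt_eq U ⟨z, hzU⟩
    ⟨restrictL h (kernelAt V ⟨z, h hzU⟩), restrictL_mem_bergmanSpace h (kernelAt V ⟨z, h hzU⟩).2⟩
  rw [h0, inner_zero_left, bergmanSpace_apply, holo_restrictL h _ hzU] at h2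
  rw [bergmanSpace_apply, ← h2] at h1
  exact inner_self_eq_zero.1 h1

/-! ### The zero set of the Bergman kernel is a null set -/

theorem volume_preimage_complex_smul {n : ℕ} {t : ℂ} (ht : t ≠ 0) {S : Set (Fin n → ℂ)}
    (hS : MeasurableSet S) (h : volume ((fun v : Fin n → ℂ => t • v) ⁻¹' S) = 0) :
    volume S = 0 := by
  have htn : ‖t‖ ≠ 0 := norm_ne_zero_iff.2 ht
  -- Polar decomposition: a unimodular factor preserves volume, and the positive real factor `‖t‖`
  -- scales it.
  set u : ℂ := t / ‖t‖ with hu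
  have hu1 : ‖u‖ = 1 := by
    rw [hu, norm_div, Complex.norm_real, norm_norm, div_self htn]
  have hmp := measurePreserving_unit_smul (n := n) u hu1
  have h1 : (fun v : Fin n → ℂ => t • v) ⁻¹' S
      = (fun v : Fin n → ℂ => ‖t‖ • v) ⁻¹' ((fun v : Fin n → ℂ => u • v) ⁻¹' S) := by
    ext v
    simp only [Set.mem_preimage]
    have : t • v = u • ‖t‖ • v := by
      rw [← Complex.coe_smul ‖t‖ v, smul_smul, hu,
        div_mul_cancel₀ _ (Complex.ofReal_ne_zero.2 htn)]
    rw [this]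
  rw [h1, Measure.addHaar_preimage_smul volume htn, mul_eq_zero] at h
  rcases h with h | h
  · rw [ENNReal.ofReal_eq_zero] at h
    exact absurd h (not_le.2 (by positivity))
  · rwa [hmp.measure_preimage hS.nullMeasurableSet] at h

/-- A set that every complex line through the origin meets in a null set is a null set. -/
theorem volume_eq_zero_of_lines {n : ℕ} {S : Set (Fin n → ℂ)} (hS : MeasurableSet S)
    (h : ∀ v : Fin n → ℂ, volume {t : ℂ | t • v ∈ S} = 0) : volume S = 0 := by
  set A : Set ((Fin n → ℂ) × ℂ) := {p | p.2 • p.1 ∈ S} with hA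
  have hAm : MeasurableSet A := by
    have : Measurable fun p : (Fin n → ℂ) × ℂ => p.2 • p.1 := by fun_prop
    exact this hS
  -- Fubini in both orders: slices at fixed `v` are null, so slices at almost every `t` are null,
  -- and a single such `t ≠ 0` suffices.
  have h1 : (volume : Measure (Fin n → ℂ)).prod (volume : Measure ℂ) A = 0 :=
    (Measure.measure_prod_null hAm).2 (.of_forall h)
  have h2 : (volume : Measure ℂ).prod (volume : Measure (Fin n → ℂ)) (Prod.swap ⁻¹' A) = 0 := by
    rw [← Measure.map_apply measurable_swap hAm, Measure.prod_swap, h1]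
  have h3 := (Measure.measure_prod_null (measurable_swap hAm)).1 h2
  have h4 : ∀ᵐ t : ℂ, t ≠ 0 := by simp [ae_iff]
  obtain ⟨t, ht1, ht2⟩ := (h3.and h4).exists
  exact volume_preimage_complex_smul ht2 hS ht1

theorem volume_zeros_ball {n : ℕ} {f : (Fin n → ℂ) → ℂ} {w a : Fin n → ℂ} {r : ℝ}
    (hf : DifferentiableOn ℂ f (ball w r)) (ha : a ∈ ball w r) (hfa : f a ≠ 0) :
    volume {z ∈ ball w r | f z = 0} = 0 := by
  have hZ : MeasurableSet {z ∈ ball w r | f z = 0} := by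
    have h1 := hf.continuousOn.isOpen_inter_preimage isOpen_ball (t := {0}ᶜ) isOpen_compl_singleton
    have h2 : {z ∈ ball w r | f z = 0} = ball w r \ (ball w r ∩ f ⁻¹' {0}ᶜ) := by
      ext z
      simp +contextual
    rw [h2]
    exact isOpen_ball.measurableSet.diff h1.measurableSet
  have hadd : Measurable fun v : Fin n → ℂ => a + v := by fun_prop
  -- Translating `a` to the origin turns complex lines through `a` into lines through `0`.
  rw [← measure_preimage_add volume a]
  refine volume_eq_zero_of_lines (hadd hZ) fun v => ?_
  set U : Set ℂ := {t | a + t • v ∈ ball w r} with hU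
  have hUo : IsOpen U := isOpen_ball.preimage (f := fun t : ℂ => a + t • v) (by fun_prop)
  have hUc : Convex ℝ U := by
    have h1 : U = (fun t : ℂ => t • v) ⁻¹' ((fun x => a + x) ⁻¹' ball w r) := rfl
    rw [h1]
    exact ((convex_ball w r).translate_preimage_right a).is_linear_preimage
      ⟨fun x y => add_smul x y v, fun c x => smul_assoc c x v⟩
  have h0 : (0 : ℂ) ∈ U := by simpa [hU] using ha
  have hg : DifferentiableOn ℂ (fun t : ℂ => f (a + t • v)) U :=
    hf.comp (by fun_prop) fun t ht => ht
  -- The slice `U` is convex, hence connected, and the one-variable function is nonzero at `0`, so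
  -- its zeros are discrete in `U`.
  have hcod := AnalyticOnNhd.preimage_zero_mem_codiscreteWithin (hg.analyticOnNhd hUo)
    (by simpa using hfa) h0 ⟨⟨0, h0⟩, hUc.isPreconnected⟩
  have hae := ae_restrict_le_codiscreteWithin (μ := volume) hUo.measurableSet hcod
  rw [mem_ae_iff, Measure.restrict_apply' hUo.measurableSet] at hae
  refine measure_mono_null (fun t ht => ?_) hae
  simp only [Set.mem_preimage, Set.mem_ofPred_eq] at ht
  exact ⟨by simpa using ht.2, ht.1⟩

/-- Near a point where `f` is not locally identically zero, its zeros are null by the ball case.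
Such points form an open set, as do the points near which `f` vanishes identically; connectedness
and `b` rule out the latter in `Ω`. -/
theorem volume_zeros {n : ℕ} {Ω : Set (Fin n → ℂ)} (hΩ : IsOpen Ω) (hc : IsPreconnected Ω)
    {f : (Fin n → ℂ) → ℂ} (hf : DifferentiableOn ℂ f Ω) {b : Fin n → ℂ} (hb : b ∈ Ω)
    (hfb : f b ≠ 0) : volume {z ∈ Ω | f z = 0} = 0 := by
  set A : Set (Fin n → ℂ) := {z ∈ Ω | ¬ ∀ᶠ x in 𝓝 z, f x = 0} with hA
  have hloc : ∀ z ∈ A, ∃ r > 0, ball z r ⊆ Ω ∧ volume {x ∈ ball z r | f x = 0} = 0 := by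
    rintro z ⟨hz, hz'⟩
    obtain ⟨r, hr, hzr⟩ := Metric.isOpen_iff.1 hΩ z hz
    have : ∃ a ∈ ball z r, f a ≠ 0 := by
      by_contra! h
      exact hz' (eventually_of_mem (ball_mem_nhds z hr) h)
    obtain ⟨a, ha, hfa⟩ := this
    exact ⟨r, hr, hzr, volume_zeros_ball (hf.mono hzr) ha hfa⟩
  have hAo : IsOpen A := by
    rw [Metric.isOpen_iff]
    intro z hz
    obtain ⟨r, hr, hzr, hnull⟩ := hloc z hz
    refine ⟨r, hr, fun x hx => ⟨hzr hx, fun hev => ?_⟩⟩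
    have h1 : {x ∈ ball z r | f x = 0} ∈ 𝓝 x :=
      (eventually_of_mem (isOpen_ball.mem_nhds hx) fun _ h => h).and hev
    exact (Measure.measure_pos_of_mem_nhds volume h1).ne' hnull
  have hBo : IsOpen {z | ∀ᶠ x in 𝓝 z, f x = 0} := isOpen_setOfPred_eventually_nhds
  have hsub : Ω ⊆ A := by
    refine hc.subset_left_of_subset_union hAo hBo ?_ ?_ ⟨b, hb, hb, fun h => hfb h.self_of_nhds⟩
    · rw [Set.disjoint_left]
      exact fun z hz h => hz.2 h
    · intro z hz
      by_cases h : ∀ᶠ x in 𝓝 z, f x = 0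
      · exact Or.inr h
      · exact Or.inl ⟨hz, h⟩
  refine measure_null_of_locally_null _ fun z hz => ?_
  obtain ⟨r, hr, -, hnull⟩ := hloc z (hsub hz.1)
  refine ⟨_, ?_, hnull⟩
  filter_upwards [self_mem_nhdsWithin, mem_nhdsWithin_of_mem_nhds (ball_mem_nhds z hr)] with x h1 h2
  exact ⟨h2, h1.2⟩

theorem volume_zeroSet {n : ℕ} {Ω : Opens (Fin n → ℂ)} (hΩ : IsNontrivialBergmanDomain Ω) :
    volume (zeroSet Ω) = 0 := by
  obtain ⟨f, hf, hf0⟩ := (Submodule.ne_bot_iff _).1 hΩ.2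
  set F : bergmanSpace Ω := ⟨f, hf⟩
  have hex : ∃ b : Ω, F b ≠ 0 := by
    by_contra! h
    have : F = 0 := RKHS.ext (𝕜 := ℂ) fun x => by rw [h x, RKHS.coe_zero, Pi.zero_apply]
    exact hf0 (congrArg Subtype.val this)
  obtain ⟨b, hb⟩ := hex
  refine measure_mono_null (fun z hz => ?_)
    (volume_zeros Ω.isOpen hΩ.1.isPreconnected (differentiableOn_holo F) b.2 hb)
  have hzΩ : z ∈ Ω := hz.1
  have h0 := (mem_zeroSet_iff (⟨z, hzΩ⟩ : Ω)).1 hz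
  have h1 := inner_kernelAt Ω ⟨z, hzΩ⟩ F
  rw [h0, inner_zero_left] at h1
  exact ⟨hzΩ, h1.symm⟩

/-! ### Convergence of Berezin transforms -/

theorem extendL_ne_zero {n : ℕ} {U V : Opens (Fin n → ℂ)} (h : U ≤ V) {g : bergmanSpace U}
    (hg : g ≠ 0) : extendL h g ≠ 0 := fun h0 => hg <| Subtype.ext <| by
  rw [← restrictL_extendL h g, h0, map_zero]
  rfl

/-- Quotients of the kind that expresses Berezin transforms are continuous under strong convergence. -/
theorem StrongTendsto.tendsto_inner_div {H X : Type*} [NormedAddCommGroup H]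
    [InnerProductSpace ℂ H] [TopologicalSpace X] {Q S : ℕ → H → H} {Q' S' : H → H}
    (hQ : StrongTendsto Q Q') (hS : StrongTendsto S S') {κ : X → H} {z : X}
    (hκ : ContinuousAt κ z) (h0 : Q' (κ z) ≠ 0) :
    Tendsto (fun p : ℕ × X => (inner ℂ (Q p.1 (κ p.2)) (S p.1 (Q p.1 (κ p.2))) : ℂ)
        / inner ℂ (Q p.1 (κ p.2)) (Q p.1 (κ p.2)))
      (atTop ×ˢ 𝓝 z)
      (𝓝 (inner ℂ (Q' (κ z)) (S' (Q' (κ z))) / inner ℂ (Q' (κ z)) (Q' (κ z)))) := by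
  have hκ' : Tendsto (fun p : ℕ × X => (p.1, κ p.2)) (atTop ×ˢ 𝓝 z) (atTop ×ˢ 𝓝 (κ z)) :=
    tendsto_fst.prodMk (hκ.tendsto.comp tendsto_snd)
  have hq := (hQ (κ z)).comp hκ'
  have hs := ((hS.comp hQ) (κ z)).comp hκ'
  exact (hq.inner hs).div (hq.inner hq) (inner_self_ne_zero.2 h0)

/-- Provides a kernel map on all of `ℂⁿ`, so that limits can be taken along `𝓝 z` in the ambient
space; its values off `U` are immaterial. -/
theorem exists_continuousAt_extendL_kernelAt {n : ℕ} {U V : Opens (Fin n → ℂ)} (h : U ≤ V)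
    {z : Fin n → ℂ} (hz : z ∈ U) :
    ∃ κ : (Fin n → ℂ) → Lp ℂ 2 (volume.restrict (V : Set (Fin n → ℂ))),
      ContinuousAt κ z ∧ ∀ w : U, κ w = extendL h (kernelAt U w) := by
  have hval : ∀ w : U, Function.extend Subtype.val
      (fun w : U => extendL h (kernelAt U w)) 0 (w : Fin n → ℂ) = extendL h (kernelAt U w) :=
    fun w => Subtype.val_injective.extend_apply _ _ w
  refine ⟨_, ?_, hval⟩
  refine (U.isOpen.isOpenEmbedding_subtypeVal.continuousAt_iff (x := ⟨z, hz⟩)).1 ?_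
  have hc : Continuous fun w : U => extendL h (kernelAt U w) :=
    (extendL h).continuous.comp (continuous_subtype_val.comp (continuous_kernelAt U))
  exact hc.continuousAt.congr (.of_forall fun w => (hval w).symm)

/-- The Berezin transforms on the sets of an exhaustion converge continuously off the zero set. -/
theorem tendsto_berezin {n l : ℕ} {k : Fin l → ℕ} {Ω : Opens (Fin n → ℂ)}
    {D : ℕ → Opens (Fin n → ℂ)} (hmono : Monotone D) (hle : ∀ j, D j ≤ Ω)
    (hunion : (⋃ j, (D j : Set (Fin n → ℂ))) = (Ω : Set (Fin n → ℂ)))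
    (φ : (m : Fin l) → Fin (k m) → Symbol Ω) {z : Fin n → ℂ}
    (hz : z ∈ (Ω : Set (Fin n → ℂ)) \ zeroSet Ω) :
    Tendsto (fun p : ℕ × (Fin n → ℂ) => zeroExtend (D p.1) (berezin (D p.1)
        (toeplitzSum (D p.1) fun m i => (φ m i).restrict (hle p.1))) p.2)
      (atTop ×ˢ 𝓝 z) (𝓝 (zeroExtend Ω (berezin Ω (toeplitzSum Ω φ)) z)) := by
  obtain ⟨i, hi⟩ : ∃ i, z ∈ D i := by
    have := hz.1
    rw [← hunion] at this
    simpa using this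
  obtain ⟨κ, hκ, hκval⟩ := exists_continuousAt_extendL_kernelAt (hle i) hi
  have hval := hκval ⟨z, hi⟩
  -- The limiting vector is the kernel of `Ω` at `z`, nonzero exactly because `z` is off the zero
  -- set.
  have hq0 : (holoOn (le_refl Ω)).starProjection (κ z) ≠ 0 := by
    rw [hval, starProjection_extendL_kernelAt (hle i) le_rfl]
    exact extendL_ne_zero _ fun h => hz.2 ((mem_zeroSet_iff (⟨z, hz.1⟩ : Ω)).2 h)
  have hlim := zeroExtend_berezin (hle i) le_rfl φ ⟨z, hi⟩ _
    (congrArg (holoOn (le_refl Ω)).starProjection hval)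
  simp only [symbolRestrict_le_rfl] at hlim
  rw [hlim]
  refine ((strongTendsto_starProjection_holoOn hmono hle hunion).tendsto_inner_div
    (strongTendsto_liftedSum hmono hle hunion φ) hκ hq0).congr' ?_
  filter_upwards [(eventually_ge_atTop i).prod_mk ((D i).isOpen.mem_nhds hi)] with p hp
  exact (zeroExtend_berezin (hmono hp.1) (hle p.1) φ ⟨p.2, hp.2⟩ _
    (congrArg (holoOn (hle p.1)).starProjection (hκval ⟨p.2, hp.2⟩))).symm

/-- The joint convergence for the constant exhaustion `D j = Ω` is continuity of the limit. -/
theorem continuousAt_berezin {n l : ℕ} {k : Fin l → ℕ} {Ω : Opens (Fin n → ℂ)}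
    (φ : (m : Fin l) → Fin (k m) → Symbol Ω) {z : Fin n → ℂ}
    (hz : z ∈ (Ω : Set (Fin n → ℂ)) \ zeroSet Ω) :
    ContinuousAt (zeroExtend Ω (berezin Ω (toeplitzSum Ω φ))) z := by
  have h := tendsto_berezin (D := fun _ => Ω) monotone_const (fun _ => le_rfl)
    (Set.iUnion_const _) φ hz
  simp only [symbolRestrict_le_rfl] at h
  have h' : Tendsto (zeroExtend Ω (berezin Ω (toeplitzSum Ω φ)))
      (map Prod.snd ((atTop : Filter ℕ) ×ˢ 𝓝 z))
      (𝓝 (zeroExtend Ω (berezin Ω (toeplitzSum Ω φ)) z)) := tendsto_map'_iff.2 h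
  rwa [map_snd_prod] at h'

/-! ### Measurability, uniform bounds and bounded convergence -/

theorem measurable_zeroExtend_berezin {n : ℕ} (Ω : Opens (Fin n → ℂ))
    (T : bergmanSpace Ω →L[ℂ] bergmanSpace Ω) : Measurable (zeroExtend Ω (berezin Ω T)) := by
  refine (MeasurableEmbedding.subtype_coe Ω.isOpen.measurableSet).measurable_extend ?_
    measurable_zero
  have h1 := continuous_kernelAt Ω
  have h2 : Continuous fun z : Ω => inner ℂ (kernelAt Ω z) (T (kernelAt Ω z)) :=
    h1.inner (𝕜 := ℂ) (T.continuous.comp h1)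
  have h3 : Continuous fun z : Ω => inner ℂ (kernelAt Ω z) (kernelAt Ω z) := h1.inner (𝕜 := ℂ) h1
  -- The quotient formula also holds on the zero set, where it reads `0 / 0 = 0`, so measurability
  -- needs no case distinction.
  rw [show berezin Ω T = _ from funext (berezin_eq Ω T)]
  exact h2.measurable.div h3.measurable

theorem norm_zeroExtend_berezin_le {n : ℕ} (Ω : Opens (Fin n → ℂ))
    (T : bergmanSpace Ω →L[ℂ] bergmanSpace Ω) (z : Fin n → ℂ) :
    ‖zeroExtend Ω (berezin Ω T) z‖ ≤ ‖T‖ := by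
  by_cases hz : z ∈ Ω
  · rw [zeroExtend_of_mem _ hz]
    exact norm_berezin_le Ω T _
  · rw [zeroExtend_of_notMem _ hz, norm_zero]
    exact norm_nonneg T

theorem norm_toeplitz_le {n : ℕ} (Ω : Opens (Fin n → ℂ)) (φ : Symbol Ω) :
    ‖toeplitz Ω φ‖ ≤ ‖φ‖ := by
  refine ContinuousLinearMap.opNorm_le_bound _ (norm_nonneg _) fun f => ?_
  have h1 : ‖(bergmanSpace Ω).orthogonalProjectionOnto (mulL φ f)‖ ≤ 1 * ‖mulL φ f‖ :=
    ContinuousLinearMap.le_of_opNorm_le _ (Submodule.orthogonalProjectionOnto_norm_le _) _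
  rw [one_mul] at h1
  exact h1.trans (ContinuousLinearMap.le_of_opNorm_le _ (norm_mulL_le φ) _)

/-- The constant is the product of the sup norms on `V`, which restriction does not increase; its
independence of `U` gives the dominating bound. -/
theorem exists_norm_list_prod_toeplitz_le {n : ℕ} {V : Opens (Fin n → ℂ)} (L : List (Symbol V)) :
    ∃ C : ℝ, ∀ (U : Opens (Fin n → ℂ)) (h : U ≤ V),
      ‖(L.map fun ψ => toeplitz U (ψ.restrict h)).prod‖ ≤ C := by
  induction L with
  | nil => exact ⟨1, fun U h => ContinuousLinearMap.norm_id_le⟩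
  | cons a L ih =>
    obtain ⟨C, hC⟩ := ih
    refine ⟨‖a‖ * C, fun U h => ?_⟩
    rw [List.map_cons, List.prod_cons]
    refine (ContinuousLinearMap.opNorm_comp_le _ _).trans ?_
    gcongr
    · exact (norm_toeplitz_le U _).trans (norm_symbolRestrict_le h a)
    · exact hC U h

theorem norm_clm_sum_le {E ι : Type*} [NormedAddCommGroup E] [NormedSpace ℂ E] [Fintype ι]
    {A : ι → E →L[ℂ] E} {C : ι → ℝ} (h : ∀ i, ‖A i‖ ≤ C i) : ‖∑ i, A i‖ ≤ ∑ i, C i :=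
  norm_sum_le_of_le _ fun i _ => h i

theorem exists_norm_toeplitzSum_le {n l : ℕ} {k : Fin l → ℕ} {V : Opens (Fin n → ℂ)}
    (φ : (m : Fin l) → Fin (k m) → Symbol V) :
    ∃ C : ℝ, ∀ (U : Opens (Fin n → ℂ)) (h : U ≤ V),
      ‖toeplitzSum U fun m i => (φ m i).restrict h‖ ≤ C := by
  choose C hC using fun m => exists_norm_list_prod_toeplitz_le (List.ofFn (φ m))
  refine ⟨∑ m, C m, fun U h => ?_⟩
  rw [toeplitzSum_apply]
  exact norm_clm_sum_le (fun m => hC m U h)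

/-- Bounded convergence in `Lᵖ` of a finite measure, for every `0 < p < ∞`. -/
theorem tendsto_eLpNorm_sub_of_bounded {α : Type*} [MeasurableSpace α] {μ : Measure α}
    [IsFiniteMeasure μ] {F : ℕ → α → ℂ} {f : α → ℂ} (hF : ∀ j, Measurable (F j))
    (hf : Measurable f) {C : ℝ} (hFC : ∀ j x, ‖F j x‖ ≤ C) (hfC : ∀ x, ‖f x‖ ≤ C)
    (hlim : ∀ᵐ x ∂μ, Tendsto (fun j => F j x) atTop (𝓝 (f x))) {p : ℝ≥0∞} (hp0 : 0 < p)
    (hp : p < ∞) : Tendsto (fun j => eLpNorm (fun x => F j x - f x) p μ) atTop (𝓝 0) := by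
  have hpr : 0 < p.toReal := ENNReal.toReal_pos hp0.ne' hp.ne
  simp only [eLpNorm_eq_lintegral_rpow_enorm_toReal hp0.ne' hp.ne]
  have h1 : Tendsto (fun j => ∫⁻ x, ‖F j x - f x‖ₑ ^ p.toReal ∂μ) atTop (𝓝 (∫⁻ _, 0 ∂μ)) := by
    refine tendsto_lintegral_of_dominated_convergence
      (fun _ => ENNReal.ofReal (C + C) ^ p.toReal) (fun j => ?_) (fun j => .of_forall fun x => ?_)
      ?_ ?_
    · exact ((hF j).sub hf).enorm.pow_const _
    · simp only
      gcongr
      rw [← ofReal_norm]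
      exact ENNReal.ofReal_le_ofReal ((norm_sub_le _ _).trans (add_le_add (hFC j x) (hfC x)))
    · rw [lintegral_const]
      exact ENNReal.mul_ne_top (ENNReal.rpow_ne_top_of_nonneg hpr.le ENNReal.ofReal_ne_top)
        (measure_ne_top _ _)
    · filter_upwards [hlim] with x hx
      have h2 : Tendsto (fun j => ‖F j x - f x‖ₑ) atTop (𝓝 0) := by
        simpa using (hx.sub_const (f x)).enorm
      simpa [hpr] using h2.ennrpow_const p.toReal
  have h2 := h1.ennrpow_const (1 / p.toReal)
  simpa [hpr] using h2

end Bergman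

end

theorem mainTheorem3 {n : ℕ} (Ω : Opens (Fin n → ℂ)) (D : ℕ → Opens (Fin n → ℂ))
    (hD : ∀ j, IsConnected (D j : Set (Fin n → ℂ)))
    (hmono : ∀ j, D j ≤ D (j + 1))
    (hle : ∀ j, D j ≤ Ω)
    (hunion : (⋃ j, (D j : Set (Fin n → ℂ))) = (Ω : Set (Fin n → ℂ)))
    (hΩ : Bergman.IsNontrivialBergmanDomain Ω)
    (l : ℕ) (k : Fin l → ℕ) (φ : (m : Fin l) → Fin (k m) → Bergman.Symbol Ω) :
    (∀ K : Set (Fin n → ℂ), IsCompact K → K ⊆ (Ω : Set (Fin n → ℂ)) \ Bergman.zeroSet Ω →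
      (∀ᶠ j in atTop, K ⊆ (D j : Set (Fin n → ℂ)) \ Bergman.zeroSet (D j)) ∧
      TendstoUniformlyOn
        (fun j => Bergman.zeroExtend (D j) (Bergman.berezin (D j)
          (Bergman.toeplitzSum (D j) fun m i => (φ m i).restrict (hle j))))
        (Bergman.zeroExtend Ω (Bergman.berezin Ω (Bergman.toeplitzSum Ω φ)))
        atTop K) ∧
    (Bornology.IsBounded (Ω : Set (Fin n → ℂ)) → ∀ p : ℝ≥0∞, 0 < p → p < ∞ →
      MemLp (Bergman.zeroExtend Ω (Bergman.berezin Ω (Bergman.toeplitzSum Ω φ))) p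
        (volume.restrict (Ω : Set (Fin n → ℂ))) ∧
      (∀ j, MemLp (Bergman.zeroExtend (D j) (Bergman.berezin (D j)
          (Bergman.toeplitzSum (D j) fun m i => (φ m i).restrict (hle j)))) p
        (volume.restrict (Ω : Set (Fin n → ℂ)))) ∧
      Tendsto (fun j => eLpNorm
        (fun z => Bergman.zeroExtend (D j) (Bergman.berezin (D j)
            (Bergman.toeplitzSum (D j) fun m i => (φ m i).restrict (hle j))) z -
          Bergman.zeroExtend Ω (Bergman.berezin Ω (Bergman.toeplitzSum Ω φ)) z) p
        (volume.restrict (Ω : Set (Fin n → ℂ)))) atTop (𝓝 0)) := by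
  have hmono' : Monotone D := monotone_nat_of_le_succ hmono
  refine ⟨fun K hK hKΩ => ⟨?_, ?_⟩, fun hb p hp0 hp => ?_⟩
  · obtain ⟨i, hi⟩ := hK.elim_directed_cover (fun j => (D j : Set (Fin n → ℂ)))
      (fun j => (D j).isOpen) (by rw [hunion]; exact hKΩ.trans Set.sdiff_subset)
      (Monotone.directed_le (f := fun j => (D j : Set (Fin n → ℂ))) hmono')
    filter_upwards [eventually_ge_atTop i] with j hj z hz
    exact ⟨hmono' hj (hi hz), fun h => (hKΩ hz).2 (Bergman.mem_zeroSet_of_le (hle j) h)⟩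
  · rw [← tendstoLocallyUniformlyOn_iff_tendstoUniformlyOn_of_compact hK,
      tendstoLocallyUniformlyOn_iff_forall_tendsto]
    intro z hz
    have h1 := (Bergman.continuousAt_berezin φ (hKΩ hz)).tendsto.comp
      (tendsto_snd (f := (atTop : Filter ℕ)) (g := 𝓝 z))
    have h2 := Bergman.tendsto_berezin hmono' hle hunion φ (hKΩ hz)
    -- Both the limit function at `w` and the approximants at `(j, w)` tend to the same value at
    -- `z`, hence become uniformly close to each other.
    exact ((h1.prodMk_nhds h2).mono_right (nhds_le_uniformity _)).mono_left
      (Filter.prod_mono le_rfl nhdsWithin_le_nhds)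
  · obtain ⟨C, hC⟩ := Bergman.exists_norm_toeplitzSum_le φ
    have hfin : IsFiniteMeasure (volume.restrict (Ω : Set (Fin n → ℂ))) :=
      ⟨by rw [Measure.restrict_apply_univ]; exact hb.measure_lt_top⟩
    have hCΩ := hC Ω le_rfl
    simp only [Bergman.symbolRestrict_le_rfl] at hCΩ
    have hf := Bergman.measurable_zeroExtend_berezin Ω (Bergman.toeplitzSum Ω φ)
    have hfC := fun z =>
      (Bergman.norm_zeroExtend_berezin_le Ω (Bergman.toeplitzSum Ω φ) z).trans hCΩ
    have hF := fun j => Bergman.measurable_zeroExtend_berezin (D j)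
      (Bergman.toeplitzSum (D j) fun m i => (φ m i).restrict (hle j))
    have hFC := fun j z => (Bergman.norm_zeroExtend_berezin_le (D j)
      (Bergman.toeplitzSum (D j) fun m i => (φ m i).restrict (hle j)) z).trans (hC (D j) (hle j))
    refine ⟨MemLp.of_bound hf.aestronglyMeasurable C (.of_forall hfC),
      fun j => MemLp.of_bound (hF j).aestronglyMeasurable C (.of_forall (hFC j)),
      Bergman.tendsto_eLpNorm_sub_of_bounded hF hf hFC hfC ?_ hp0 hp⟩
    have hZ : ∀ᵐ z ∂(volume.restrict (Ω : Set (Fin n → ℂ))), z ∉ Bergman.zeroSet Ω :=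
      ae_restrict_of_ae (measure_eq_zero_iff_ae_notMem.1 (Bergman.volume_zeroSet hΩ))
    filter_upwards [hZ, ae_restrict_mem Ω.isOpen.measurableSet] with z h1 h2
    exact (Bergman.tendsto_berezin hmono' hle hunion φ ⟨h2, h1⟩).comp
      (tendsto_id.prodMk (tendsto_const_nhds (x := z)))
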